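/- Let $\Gamma$ be an infinite connected graph without loops and multiple edges, with symmetric weights $\mu_{x,y}=\mu_{y,x}$ that are positive exactly on the edges $x\sim y$ and satisfy $\mu(x)=\sum_{y\sim x}\mu_{x,y}<\infty$ for every vertex $x$. Let $(X_n)_{n\ge 0}$ be the random walk with transition probabilities $P(x,y)=\mu_{x,y}/\mu(x)$, let $\mathbb P_x,\mathbb E_x$ be its law and expectation when $X_0=x$, and put $$p_n(x,y)=\frac{\mathbb P_x(X_n=y)}{\mu(y)},\qquad \widetilde p_n(x,y)=p_n(x,y)+p_{n+1}(x,y).$$ Let $d(x,y)$ be the graph distance, $B(x,R)=\{y: d(x,y)<R\}$ and $V(x,R)=\sum_{y\in B(x,R)}\mu(y)$. For a vertex set $A$ let $T_A=\inf\{t\ge 0: X_t\notin A\}$, and put $E(x,R)=\mathbb E_x\,T_{B(x,R)}$ and $e(x,n)=\min\{r\in\mathbb N: E(x,r)\ge n\}$. Let $\pi_{x,y}$ be the set of all vertices on shortest paths from $x$ to $y$. For a constant $Q>0$, vertices $x\ne y$ and real $s>0$, let $l_9(x,y,s)$ be the minimal integer $l\ge 1$ for which $$\frac{s}{l}\ \ge\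 Q\max_{z\in\pi_{x,y}}E\Big(z,\frac{9\,d(x,y)}{l}\Big),$$ and $l_9(x,y,s)=d(x,y)$ if there is no such integer. Assume that * $(p_0)$ there is $p_0>0$ with $P(x,y)\ge p_0$ for all $x\sim y$; * $(\overline E)$ there is $C>0$ with $\max_{y\in B(x,R)}\mathbb E_y\,T_{B(x,R)}\le C\,E(x,R)$ for all vertices $x$ and real $R>0$; * $(H)$ (elliptic Harnack inequality) there is $C>0$ such that for all vertices $x$, all real $R>0$ and every function $u\ge 0$, defined on $B(x,2R)$ and its neighbours, with $\sum_{y}P(z,y)u(y)=u(z)$ for all $z\in B(x,2R)$, one has $\max_{B(x,R)}u\le C\min_{B(x,R)}u$. Then there is a constant $Q_0>0$ such that for every fixed $Q\ge Q_0$ in the definition of $l_9$ there are constants $c,C,D>0$ such that for all vertices $x\neq y$ and all integers $n\ge d(x,y)$, $$\widetilde p_n(x,y)\ \ge\ \frac{c}{V(x,e(x,n))\,r^{D}}\,\exp\Big(-C\,l_9\big(x,y,\tfrac n2\big)\Big),\qquad r=\frac{d(x,y)}{3l},\quad l=l_9\big(x,y,\tfrac n2\big).$$ -/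

import Mathlib

open MeasureTheory ProbabilityTheory
open scoped ENNReal

noncomputable section

/-- An infinite connected graph (no loops, no multiple edges) with a symmetric weight that is
positive exactly on the edges and has finite total mass at every vertex. -/
structure WeightedGraph (V : Type*) where
  graph : SimpleGraph V
  infinite : Infinite V
  connected : graph.Connected
  weight : V → V → ℝ
  weight_symm : ∀ x y, weight x y = weight y x
  weight_pos : ∀ x y, graph.Adj x y → 0 < weight x y
  weight_zero : ∀ x y, ¬ graph.Adj x y → weight x y = 0
  summable_weight : ∀ x, Summable (weight x)

namespace WeightedGraph

variable {V : Type*} (Γ : WeightedGraph V)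

/-- The measure of a vertex, `μ(x) = ∑_{y ∼ x} μ_{x,y}`. -/
def mu (x : V) : ℝ := ∑' y, Γ.weight x y

/-- The one-step transition probabilities `P(x,y) = μ_{x,y} / μ(x)`. -/
def P (x y : V) : ℝ := Γ.weight x y / Γ.mu x

lemma weight_nonneg (x y : V) : 0 ≤ Γ.weight x y := by
  by_cases h : Γ.graph.Adj x y
  · exact (Γ.weight_pos x y h).le
  · exact (Γ.weight_zero x y h).ge

lemma mu_pos (x : V) : 0 < Γ.mu x := by
  have := Γ.infinite
  obtain ⟨y, hy⟩ := Γ.connected.preconnected.exists_adj_of_nontrivial x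
  exact (Γ.summable_weight x).tsum_pos (Γ.weight_nonneg x) y (Γ.weight_pos x y hy)

lemma P_nonneg (x y : V) : 0 ≤ Γ.P x y := div_nonneg (Γ.weight_nonneg x y) (Γ.mu_pos x).le

lemma hasSum_P (x : V) : HasSum (Γ.P x) 1 := by
  have h := (Γ.summable_weight x).hasSum.div_const (Γ.mu x)
  rwa [show (∑' y, Γ.weight x y) / Γ.mu x = 1 from div_self (Γ.mu_pos x).ne'] at h

/-- The open ball `B(x,R) = {y : d(x,y) < R}` of the graph distance. -/
def ball (x : V) (R : ℝ) : Set V := {y | (Γ.graph.dist x y : ℝ) < R}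

/-- The volume `V(x,R) = μ(B(x,R))`. -/
def vol (x : V) (R : ℝ) : ℝ := ∑' y : Γ.ball x R, Γ.mu y

/-- The closure `{y : ∃ x ∈ A, x ∼ y}` of a vertex set. -/
def closure (A : Set V) : Set V := {y | ∃ x ∈ A, Γ.graph.Adj x y}

/-- Harmonicity on `A`: `∑_y P(x,y) h(y) = h(x)` for all `x ∈ A`
(only the values of `h` on `A` and on its closure matter). -/
def HarmonicOn (h : V → ℝ) (A : Set V) : Prop := ∀ x ∈ A, ∑' y, Γ.P x y * h y = h x

/-- The union of the vertices of all shortest paths from `x` to `y`. -/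
def geod (x y : V) : Set V :=
  {z | ∃ p : Γ.graph.Walk x y, p.length = Γ.graph.dist x y ∧ z ∈ p.support}

/-- The condition `(p₀)`. -/
def CondP0 : Prop := ∃ p₀ : ℝ, 0 < p₀ ∧ ∀ x y, Γ.graph.Adj x y → p₀ ≤ Γ.P x y

/-- The elliptic Harnack inequality `(H)`. -/
def CondH : Prop := ∃ C : ℝ, 0 < C ∧ ∀ (x : V) (R : ℝ), 0 < R → ∀ u : V → ℝ,
  (∀ z ∈ Γ.ball x (2 * R) ∪ Γ.closure (Γ.ball x (2 * R)), 0 ≤ u z) →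
  Γ.HarmonicOn u (Γ.ball x (2 * R)) →
  ∀ y ∈ Γ.ball x R, ∀ z ∈ Γ.ball x R, u y ≤ C * u z

/-- The exit time `T_A = inf {t ≥ 0 : X_t ∉ A}` of a trajectory (infinite if it stays in `A`). -/
def exitTime (A : Set V) (ω : ℕ → V) : ℕ∞ := ⨅ (t : ℕ) (_ : ω t ∉ A), (t : ℕ∞)

section Walk

variable [MeasurableSpace V] [DiscreteMeasurableSpace V]

/-- The Markov kernel `x ↦ P(x, ·)` of the random walk. -/
def stepKernel : Kernel V V where
  toFun x := Measure.sum fun y => ENNReal.ofReal (Γ.P x y) • Measure.dirac y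
  measurable' := Measurable.of_discrete

instance : IsMarkovKernel Γ.stepKernel := ⟨fun x => ⟨by
  change (Measure.sum fun y => ENNReal.ofReal (Γ.P x y) • Measure.dirac y) Set.univ = 1
  rw [Measure.sum_apply _ MeasurableSet.univ]
  simp only [Measure.smul_apply, measure_univ, smul_eq_mul, mul_one]
  rw [← ENNReal.ofReal_tsum_of_nonneg (Γ.P_nonneg x) (Γ.hasSum_P x).summable,
    (Γ.hasSum_P x).tsum_eq, ENNReal.ofReal_one]⟩⟩

/-- The conditional law of `X_{n+1}` given `X_0, …, X_n`: it depends on `X_n` only. -/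
def histKernel (n : ℕ) : Kernel ((i : Finset.Iic n) → (fun _ : ℕ => V) i) V :=
  Γ.stepKernel.comap (fun h => h ⟨n, Finset.mem_Iic.2 le_rfl⟩) (measurable_pi_apply _)

instance (n : ℕ) : IsMarkovKernel (Γ.histKernel n) := by
  unfold histKernel; infer_instance

/-- The law `ℙ_x` on trajectories of the random walk `(X_n)` started at `X_0 = x`. -/
def law (x : V) : Measure (ℕ → V) :=
  Kernel.traj (X := fun _ : ℕ => V) Γ.histKernel 0 (fun _ => x)

/-- The `n`-step transition probabilities `P_n(x,y) = ℙ_x(X_n = y)`. -/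
def Pn (n : ℕ) (x y : V) : ℝ := (Γ.law x).real {ω | ω n = y}

/-- The heat kernel `p_n(x,y) = P_n(x,y) / μ(y)`. -/
def heat (n : ℕ) (x y : V) : ℝ := Γ.Pn n x y / Γ.mu y

/-- `p̃_n(x,y) = p_n(x,y) + p_{n+1}(x,y)`. -/
def heatTilde (n : ℕ) (x y : V) : ℝ := Γ.heat n x y + Γ.heat (n + 1) x y

/-- The mean exit time `E_y(A) = 𝔼(T_A | X_0 = y)`. -/
def meanExit (y : V) (A : Set V) : ℝ≥0∞ := ∫⁻ ω, ((exitTime A ω : ℕ∞) : ℝ≥0∞) ∂(Γ.law y)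

/-- `E(x,R) = E_x(B(x,R))`. -/
def E (x : V) (R : ℝ) : ℝ≥0∞ := Γ.meanExit x (Γ.ball x R)

/-- The maximal mean exit time `Ē(x,R) = max_{y ∈ B(x,R)} E_y(B(x,R))`. -/
def Ebar (x : V) (R : ℝ) : ℝ≥0∞ := ⨆ y ∈ Γ.ball x R, Γ.meanExit y (Γ.ball x R)

/-- The condition `(Ē)`. -/
def CondEbar : Prop := ∃ C : ℝ, 0 < C ∧ ∀ (x : V) (R : ℝ), 0 < R →
  Γ.Ebar x R ≤ ENNReal.ofReal C * Γ.E x R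

/-- The inverse `e(x,n) = min {r ∈ ℕ : E(x,r) ≥ n}` of the mean exit time. -/
def e (x : V) (n : ℕ) : ℕ := sInf {r : ℕ | (n : ℝ≥0∞) ≤ Γ.E x r}

/-- The positive integers `l` with `n / l ≥ Q max_{z ∈ π_{x,y}} E(z, C R / l)`. -/
def chainSet (Q C : ℝ) (x y : V) (n R : ℝ) : Set ℕ :=
  {l | 0 < l ∧ ENNReal.ofReal Q * (⨆ z ∈ Γ.geod x y, Γ.E z (C * R / l)) ≤ ENNReal.ofReal (n / l)}

open Classical in
/-- `l_C(x,y,n,R)`: the minimal positive integer `l` with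
`n / l ≥ Q max_{z ∈ π_{x,y}} E(z, C R / l)`, and `R` if there is none. -/
def chainLength (Q C : ℝ) (x y : V) (n R : ℝ) : ℝ :=
  if (Γ.chainSet Q C x y n R).Nonempty then ((sInf (Γ.chainSet Q C x y n R) : ℕ) : ℝ) else R

end Walk

end WeightedGraph

end

/-! ### From the law on trajectories to deterministic recursions -/

noncomputable section

namespace WeightedGraph

variable {V : Type*} (Γ : WeightedGraph V)

/-! The walk started at `y` first has to find `x`, and afterwards to be back at `x`. Both `heatTilde
· · x` and `hit {x}` obey the same one-step recursion away from `x`, so p̃_n(x,y) is at least a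
lower bound for all p̃_j(x,x), j < n, times the probability of hitting `x` from `y` by time n
(`mul_hit_le_heatTilde`). Adding two consecutive times disposes of parity.

Diagonal factor (`EbarBound.diagonal`): put R = e(x,n) and 2m ≤ n. By (Ē), E(x,R) ≤ m + C E(x,R)
ℙ_x(T > m), and E(x,R) ≥ n, so the walk survives in B(x,R) up to time m with probability at least
1/(2C). Symmetry and Cauchy–Schwarz turn this into p_{2m}(x,x) ≥ c / V(x,R).

Hitting factor: the core is `HitBound`, that B(z,k) is reached from distance at most 9k, in time of
order E(z,10k), with probability bounded below. Let g be the Green function of B(z,10k) with pole z.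
The Harnack inequality bounds g on the sphere of radius k by A g(w). Stopping the walk from w at the
sphere, at the exit, or at time s gives g(w) ≤ A g(w) (hitting + survival probability), and Markov's
inequality with (Ē) makes the survival term small.

Iterating along a geodesic through 6l balls of radius about r costs exp(-Cl) and uses half the time.
The last ball is then shrunk to the point `x` by factors of about 5; the number of scales is
logarithmic in r, which costs r^(-D), and the times add up geometrically because E(x,5R) exceeds
E(x,R) by a fixed factor (`EbarBound.growth`). If r ≤ 1, following one geodesic, at cost p₀^d, is
enough. -/

lemma P_eq_zero {x y : V} (h : ¬ Γ.graph.Adj x y) : Γ.P x y = 0 := by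
  simp [P, Γ.weight_zero x y h]

/-- Every vertex has finitely many neighbours. -/
def LocallyFin : Prop := ∀ x, {y | Γ.graph.Adj x y}.Finite

lemma CondP0.locallyFin {Γ : WeightedGraph V} (h : Γ.CondP0) : Γ.LocallyFin := by
  obtain ⟨p, hp, hP⟩ := h
  intro x
  have hs := (Γ.hasSum_P x).summable.tendsto_cofinite_zero
  have := hs.eventually (gt_mem_nhds hp)
  rw [Filter.eventually_cofinite] at this
  exact this.subset fun y hy => not_lt.2 (hP x y hy)

/-- The Markov operator `f ↦ ∑_y P(·, y) f(y)`. -/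
def avg (f : V → ℝ) (x : V) : ℝ := ∑' y, Γ.P x y * f y

/-- The iterates `((1_A P)^n 1_A f)(x) = 𝔼_x (f(X_n); X_0, …, X_n ∈ A)`. -/
def killed (A : Set V) (f : V → ℝ) : ℕ → V → ℝ
  | 0 => A.indicator f
  | n + 1 => A.indicator (Γ.avg (killed A f n))

variable {Γ}

lemma LocallyFin.summable (hf : Γ.LocallyFin) (f : V → ℝ) (x : V) :
    Summable fun y => Γ.P x y * f y := by
  refine summable_of_hasFiniteSupport ((hf x).subset fun y hy => ?_)
  by_contra h
  exact hy (by simp [Γ.P_eq_zero h])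

lemma avg_nonneg {f : V → ℝ} (h : ∀ y, 0 ≤ f y) (x : V) : 0 ≤ Γ.avg f x :=
  tsum_nonneg fun y => mul_nonneg (Γ.P_nonneg x y) (h y)

lemma killed_nonneg {A : Set V} {f : V → ℝ} (h : ∀ y, 0 ≤ f y) (n : ℕ) (x : V) :
    0 ≤ Γ.killed A f n x := by
  induction n generalizing x with
  | zero => exact Set.indicator_nonneg (fun y _ => h y) x
  | succ n ih => exact Set.indicator_nonneg (fun y _ => avg_nonneg ih y) x

/-- `killed` recurs on the first step, while the trajectory measure is built by appending a last
step; this identity reconciles the two. -/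
lemma killed_succ' (A : Set V) (f : V → ℝ) (n : ℕ) :
    Γ.killed A f (n + 1) = Γ.killed A (Γ.avg (A.indicator f)) n := by
  induction n with
  | zero => rfl
  | succ n ih =>
    conv_lhs => rw [killed, ih]
    rfl

/-- The path stays in `A` up to time `n`. -/
def stays (A : Set V) (n : ℕ) : Set (ℕ → V) := {ω | ∀ i ≤ n, ω i ∈ A}

lemma frestrict_indicator (A : Set V) (g : V → ℝ≥0∞) (n : ℕ) (ω : ℕ → V) :
    (stays A n).indicator (fun ω => g (ω n)) ω =
      {h : (i : Finset.Iic n) → (fun _ : ℕ => V) i | ∀ i, h i ∈ A}.indicator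
        (fun h => g (h ⟨n, Finset.mem_Iic.2 le_rfl⟩)) (Preorder.frestrictLe n ω) := by
  classical
  simp only [Set.indicator_apply, stays, Set.mem_ofPred_eq, Preorder.frestrictLe_apply]
  congr 1
  simp

/-- T counts the times n < T, and n < T means that the path is in `A` up to time n. -/
lemma exitTime_eq_tsum (A : Set V) (ω : ℕ → V) :
    ((exitTime A ω : ℕ∞) : ℝ≥0∞) = ∑' n, (stays A n).indicator 1 ω := by
  have key : ∀ n : ℕ, ω ∈ stays A n ↔ (n : ℕ∞) < exitTime A ω := by
    intro n
    rw [exitTime, ← ENat.add_one_le_iff (ENat.natCast_ne_top n)]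
    simp only [le_iInf_iff, stays]
    constructor
    · intro h t ht
      have : n < t := by
        by_contra hc
        exact ht (h t (by omega))
      exact_mod_cast this
    · intro h i hi
      by_contra hc
      have := h i hc
      have : n + 1 ≤ i := by exact_mod_cast this
      omega
  rcases eq_or_ne (exitTime A ω) ⊤ with h | h
  · have : ∀ n, (stays A n).indicator (1 : (ℕ → V) → ℝ≥0∞) ω = 1 := fun n => by
      rw [Set.indicator_of_mem ((key n).2 (by rw [h]; exact ENat.natCast_lt_top n))]; rfl
    simp [this, h]
  · obtain ⟨m, h⟩ := ENat.ne_top_iff_exists.1 h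
    replace h := h.symm
    rw [tsum_eq_sum (s := Finset.range m)]
    · rw [Finset.sum_congr rfl (g := fun _ => 1)]
      · simp [h]
      · intro n hn
        rw [Set.indicator_of_mem ((key n).2 (by rw [h]; exact_mod_cast Finset.mem_range.1 hn))]; rfl
    · intro n hn
      rw [Set.indicator_of_notMem]
      intro hc
      have := (key n).1 hc
      rw [h] at this
      exact hn (Finset.mem_range.2 (by exact_mod_cast this))

variable [MeasurableSpace V] [DiscreteMeasurableSpace V]

lemma lintegral_stepKernel (g : V → ℝ≥0∞) (x : V) :
    ∫⁻ y, g y ∂(Γ.stepKernel x) = ∑' y, ENNReal.ofReal (Γ.P x y) * g y := by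
  change ∫⁻ y, g y ∂(Measure.sum fun y => ENNReal.ofReal (Γ.P x y) • Measure.dirac y) = _
  rw [lintegral_sum_measure]
  simp [lintegral_smul_measure]

lemma LocallyFin.lintegral_ofReal (hf : Γ.LocallyFin) {f : V → ℝ} (h : ∀ y, 0 ≤ f y) (x : V) :
    ∫⁻ y, ENNReal.ofReal (f y) ∂(Γ.stepKernel x) = ENNReal.ofReal (Γ.avg f x) := by
  rw [lintegral_stepKernel, avg, ENNReal.ofReal_tsum_of_nonneg
    (fun y => mul_nonneg (Γ.P_nonneg x y) (h y)) (hf.summable f x)]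
  exact tsum_congr fun y => (ENNReal.ofReal_mul (Γ.P_nonneg x y)).symm

lemma measurable_hist_indicator (A : Set V) (g : V → ℝ≥0∞) (n : ℕ) :
    Measurable ({h : (i : Finset.Iic n) → (fun _ : ℕ => V) i | ∀ i, h i ∈ A}.indicator
        (fun h => g (h ⟨n, Finset.mem_Iic.2 le_rfl⟩))) := by
  refine Measurable.indicator (Measurable.of_discrete.comp (measurable_pi_apply _)) ?_
  rw [Set.ofPred_forall]
  exact MeasurableSet.iInter fun i => measurable_pi_apply i (.of_discrete : MeasurableSet A)

lemma measurableSet_stays (A : Set V) (n : ℕ) : MeasurableSet (stays A n) := by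
  have : stays A n = ⋂ i ≤ n, {ω | ω i ∈ A} := by ext; simp [stays]
  rw [this]
  exact .iInter fun i => .iInter fun _ => measurable_pi_apply i (.of_discrete : MeasurableSet A)

lemma lintegral_law_eq (A : Set V) (g : V → ℝ≥0∞) (n : ℕ) (x : V) :
    ∫⁻ ω, (stays A n).indicator (fun ω => g (ω n)) ω ∂(Γ.law x) =
      ∫⁻ h, {h : (i : Finset.Iic n) → (fun _ : ℕ => V) i | ∀ i, h i ∈ A}.indicator
        (fun h => g (h ⟨n, Finset.mem_Iic.2 le_rfl⟩)) h
        ∂(Kernel.partialTraj (X := fun _ : ℕ => V) Γ.histKernel 0 n (fun _ => x)) := by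
  rw [← Kernel.traj_map_frestrictLe_apply, lintegral_map (measurable_hist_indicator A g n)
    (Preorder.measurable_frestrictLe n)]
  exact lintegral_congr fun ω => frestrict_indicator A g n ω

/-- Markov property at time n: the Ionescu-Tulcea construction appends one coordinate, drawn from a
kernel that sees only the last one. -/
lemma lintegral_law_succ (A : Set V) (g : V → ℝ≥0∞) (n : ℕ) (x : V) :
    ∫⁻ ω, (stays A (n + 1)).indicator (fun ω => g (ω (n + 1))) ω ∂(Γ.law x) =
      ∫⁻ ω, (stays A n).indicator
        (fun ω => ∫⁻ y, A.indicator g y ∂(Γ.stepKernel (ω n))) ω ∂(Γ.law x) := by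
  rw [lintegral_law_eq, lintegral_law_eq A (fun v => ∫⁻ y, A.indicator g y ∂(Γ.stepKernel v)),
    Kernel.partialTraj_succ_eq_comp (Nat.zero_le n),
    Kernel.lintegral_comp _ _ _ (measurable_hist_indicator A g (n + 1))]
  refine lintegral_congr fun h => ?_
  generalize hF : {h : (i : Finset.Iic (n + 1)) → (fun _ : ℕ => V) i | ∀ i, h i ∈ A}.indicator
        (fun h => g (h ⟨n + 1, Finset.mem_Iic.2 le_rfl⟩)) = F
  have hFm : Measurable F := hF ▸ measurable_hist_indicator A g (n + 1)
  have hm : Measurable (IicProdIoc (X := fun _ : ℕ => V) n (n + 1)) := measurable_IicProdIoc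
  rw [Kernel.partialTraj_succ_self, Kernel.lintegral_map _ hm _ hFm]
  refine (Kernel.lintegral_id_prod (f := F ∘ IicProdIoc (X := fun _ : ℕ => V) n (n + 1))
    (hFm.comp hm) _ _).trans ?_
  refine (Kernel.lintegral_map _ (MeasurableEquiv.measurable _) _
      ((hFm.comp hm).comp measurable_prodMk_left)).trans ?_
  rw [histKernel, Kernel.comap_apply]
  by_cases hA : ∀ i, h i ∈ A
  · rw [Set.indicator_of_mem (by exact hA)]
    refine lintegral_congr fun y => ?_
    rw [← hF, Function.comp_apply, Function.comp_apply]
    by_cases hy : y ∈ A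
    · rw [Set.indicator_of_mem hy, Set.indicator_of_mem]
      · simp [IicProdIoc, MeasurableEquiv.piSingleton]
      · intro i
        by_cases hi : i.1 ≤ n
        · simpa [IicProdIoc, hi] using hA ⟨i.1, Finset.mem_Iic.2 hi⟩
        · simpa [IicProdIoc, MeasurableEquiv.piSingleton, hi] using hy
    · rw [Set.indicator_of_notMem hy, Set.indicator_of_notMem]
      intro hc
      have := hc ⟨n + 1, Finset.mem_Iic.2 le_rfl⟩
      exact hy (by simpa [IicProdIoc, MeasurableEquiv.piSingleton] using this)
  · rw [Set.indicator_of_notMem (by exact hA), ← lintegral_zero]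
    refine lintegral_congr fun y => ?_
    rw [← hF, Function.comp_apply, Function.comp_apply, Set.indicator_of_notMem]
    intro hc
    refine hA fun i => ?_
    have hi := Finset.mem_Iic.1 i.2
    have := hc ⟨i.1, Finset.mem_Iic.2 (by omega)⟩
    simpa [IicProdIoc, hi] using this

/-- The bridge from probability to analysis: heat kernels and mean exit times become iterates of a
killed operator, and all later estimates are inductions on those. -/
lemma LocallyFin.lintegral_law (hf : Γ.LocallyFin) (A : Set V) (n : ℕ) (x : V) {f : V → ℝ}
    (h : ∀ y, 0 ≤ f y) :
    ∫⁻ ω, (stays A n).indicator (fun ω => ENNReal.ofReal (f (ω n))) ω ∂(Γ.law x) =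
      ENNReal.ofReal (Γ.killed A f n x) := by
  induction n generalizing f with
  | zero =>
    rw [lintegral_law_eq A (fun v => ENNReal.ofReal (f v)), Kernel.partialTraj_self,
      Kernel.id_apply]
    refine (lintegral_dirac' _ (measurable_hist_indicator A (fun v => ENNReal.ofReal (f v)) 0)).trans ?_
    by_cases hx : x ∈ A <;> simp [killed, hx]
  | succ n ih =>
    have h' : ∀ y, 0 ≤ A.indicator f y := Set.indicator_nonneg fun y _ => h y
    rw [lintegral_law_succ A (fun v => ENNReal.ofReal (f v)), killed_succ', ← ih (avg_nonneg h')]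
    congr! with ω v
    rw [← hf.lintegral_ofReal h']
    refine lintegral_congr fun y => ?_
    by_cases hy : y ∈ A <;> simp [hy]

lemma LocallyFin.law_stays (hf : Γ.LocallyFin) (A : Set V) (n : ℕ) (x : V) :
    Γ.law x (stays A n) = ENNReal.ofReal (Γ.killed A 1 n x) := by
  rw [← hf.lintegral_law A n x (f := 1) (fun _ => zero_le_one)]
  simp only [Pi.one_apply, ENNReal.ofReal_one]
  rw [show (fun ω => (stays A n).indicator (fun _ : ℕ → V => (1 : ℝ≥0∞)) ω) =
    (stays A n).indicator 1 from rfl, lintegral_indicator_one (measurableSet_stays A n)]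

lemma LocallyFin.Pn_eq (hf : Γ.LocallyFin) (n : ℕ) (x y : V) :
    Γ.Pn n x y = Γ.killed Set.univ (Set.indicator {y} 1) n x := by
  have h0 : ∀ z, (0 : ℝ) ≤ Set.indicator {y} 1 z :=
    Set.indicator_nonneg fun _ _ => zero_le_one
  have := hf.lintegral_law Set.univ n x h0
  have hs : stays (Set.univ : Set V) n = Set.univ := by simp [stays]
  rw [Pn, Measure.real, ← ENNReal.toReal_ofReal (killed_nonneg h0 n x), ← this, hs,
    ← lintegral_indicator_one]
  · congr 2
    ext ω
    by_cases hy : ω n = y <;> simp [hy]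
  · exact measurable_pi_apply (X := fun _ : ℕ => V) n (.of_discrete : MeasurableSet {y})

lemma LocallyFin.meanExit_eq (hf : Γ.LocallyFin) (x : V) (A : Set V) :
    Γ.meanExit x A = ∑' n, ENNReal.ofReal (Γ.killed A 1 n x) := by
  simp only [meanExit, exitTime_eq_tsum]
  rw [lintegral_tsum fun n => (measurable_one.indicator (measurableSet_stays A n)).aemeasurable]
  refine tsum_congr fun n => ?_
  rw [lintegral_indicator_one (measurableSet_stays A n), hf.law_stays]

end WeightedGraph
end

/-! ### The killed walk: linearity, Chapman–Kolmogorov and reversibility -/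

noncomputable section

namespace WeightedGraph

variable {V : Type*} {Γ : WeightedGraph V}

lemma LocallyFin.avg_mono (hf : Γ.LocallyFin) {f g : V → ℝ} {x : V}
    (h : ∀ y, Γ.graph.Adj x y → f y ≤ g y) : Γ.avg f x ≤ Γ.avg g x := by
  refine (hf.summable f x).tsum_le_tsum (fun y => ?_) (hf.summable g x)
  by_cases hy : Γ.graph.Adj x y
  · exact mul_le_mul_of_nonneg_left (h y hy) (Γ.P_nonneg x y)
  · simp [Γ.P_eq_zero hy]

lemma LocallyFin.avg_add (hf : Γ.LocallyFin) (f g : V → ℝ) (x : V) :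
    Γ.avg (fun y => f y + g y) x = Γ.avg f x + Γ.avg g x := by
  simp only [avg, mul_add]
  exact (hf.summable f x).tsum_add (hf.summable g x)

lemma avg_const_mul (c : ℝ) (f : V → ℝ) (x : V) :
    Γ.avg (fun y => c * f y) x = c * Γ.avg f x := by
  simp only [avg, mul_left_comm _ c, tsum_mul_left]

lemma avg_const (c : ℝ) (x : V) : Γ.avg (fun _ => c) x = c := by
  simp [avg, tsum_mul_right, (Γ.hasSum_P x).tsum_eq]

lemma LocallyFin.avg_sub (hf : Γ.LocallyFin) (f g : V → ℝ) (x : V) :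
    Γ.avg (fun y => f y - g y) x = Γ.avg f x - Γ.avg g x := by
  simp only [avg, mul_sub]
  exact (hf.summable f x).tsum_sub (hf.summable g x)

lemma LocallyFin.avg_eq_sum (hf : Γ.LocallyFin) (f : V → ℝ) (x : V) :
    Γ.avg f x = ∑ y ∈ (hf x).toFinset, Γ.P x y * f y :=
  tsum_eq_sum fun y hy => by
    rw [Γ.P_eq_zero (by simpa using hy), zero_mul]

lemma LocallyFin.avg_sum (hf : Γ.LocallyFin) {ι : Type*} (s : Finset ι) (f : ι → V → ℝ) (x : V) :
    Γ.avg (fun y => ∑ i ∈ s, f i y) x = ∑ i ∈ s, Γ.avg (f i) x := by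
  simp only [avg, Finset.mul_sum]
  exact Summable.tsum_finsetSum fun i _ => hf.summable (f i) x

lemma LocallyFin.mul_le_avg (hf : Γ.LocallyFin) {f : V → ℝ} (h : ∀ y, 0 ≤ f y) (x y : V) :
    Γ.P x y * f y ≤ Γ.avg f x :=
  (hf.summable f x).le_tsum y fun z _ => mul_nonneg (Γ.P_nonneg x z) (h z)

lemma LocallyFin.hasSum_avg (hf : Γ.LocallyFin) {ι : Type*} {F : ι → V → ℝ} {G : V → ℝ}
    (h : ∀ z, HasSum (fun i => F i z) (G z)) (x : V) :
    HasSum (fun i => Γ.avg (F i) x) (Γ.avg G x) := by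
  simp only [hf.avg_eq_sum]
  exact hasSum_sum fun y _ => (h y).mul_left _

section Killed

variable (A : Set V)

lemma killed_of_notMem {A : Set V} {x : V} (hx : x ∉ A) (f : V → ℝ) (n : ℕ) :
    Γ.killed A f n x = 0 := by
  cases n <;> simp [killed, hx]

lemma killed_zero_of_mem {A : Set V} {x : V} (hx : x ∈ A) (f : V → ℝ) :
    Γ.killed A f 0 x = f x := by
  simp [killed, hx]

lemma killed_succ_of_mem {A : Set V} {x : V} (hx : x ∈ A) (f : V → ℝ) (n : ℕ) :
    Γ.killed A f (n + 1) x = Γ.avg (Γ.killed A f n) x := by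
  simp [killed, hx]

lemma LocallyFin.killed_mono (hf : Γ.LocallyFin) {f g : V → ℝ} (h : ∀ y, f y ≤ g y) (n : ℕ)
    (x : V) : Γ.killed A f n x ≤ Γ.killed A g n x := by
  induction n generalizing x with
  | zero => exact Set.indicator_le_indicator (h x)
  | succ n ih => exact Set.indicator_le_indicator (hf.avg_mono fun y _ => ih y)

lemma killed_add_time (f : V → ℝ) (m n : ℕ) :
    Γ.killed A f (m + n) = Γ.killed A (Γ.killed A f n) m := by
  induction m with
  | zero =>
    rw [zero_add]
    cases n <;> simp [killed, Set.indicator_indicator]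
  | succ m ih => rw [Nat.succ_add, killed, ih]; rfl

lemma LocallyFin.killed_sum (hf : Γ.LocallyFin) {ι : Type*} (s : Finset ι) (c : ι → ℝ)
    (f : ι → V → ℝ) (n : ℕ) (x : V) :
    Γ.killed A (fun y => ∑ i ∈ s, c i * f i y) n x = ∑ i ∈ s, c i * Γ.killed A (f i) n x := by
  induction n generalizing x with
  | zero => by_cases hx : x ∈ A <;> simp [killed, hx]
  | succ n ih =>
    by_cases hx : x ∈ A
    · simp only [killed_succ_of_mem hx]
      rw [funext ih, hf.avg_sum]
      simp only [avg_const_mul]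
    · simp [killed_of_notMem hx]

variable (Γ) in
/-- The transition probabilities `ℙ_x(X_n = y; X_0, …, X_n ∈ A)` of the killed walk. -/
def kill (n : ℕ) (x y : V) : ℝ := Γ.killed A (Set.indicator {y} 1) n x

variable (Γ) in
/-- The survival probability `ℙ_x(T_A > n)`. -/
def surv (n : ℕ) (x : V) : ℝ := Γ.killed A 1 n x

lemma single_nonneg (y z : V) : (0 : ℝ) ≤ Set.indicator {y} 1 z :=
  Set.indicator_nonneg (fun _ _ => zero_le_one) z

lemma kill_nonneg (n : ℕ) (x y : V) : 0 ≤ Γ.kill A n x y := killed_nonneg (single_nonneg y) n x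

lemma surv_nonneg (n : ℕ) (x : V) : 0 ≤ Γ.surv A n x := killed_nonneg (fun _ => zero_le_one) n x

lemma LocallyFin.kill_le_surv (hf : Γ.LocallyFin) (n : ℕ) (x y : V) :
    Γ.kill A n x y ≤ Γ.surv A n x :=
  hf.killed_mono A (fun z => by by_cases h : z = y <;> simp [h]) n x

lemma LocallyFin.surv_antitone (hf : Γ.LocallyFin) (x : V) : Antitone fun n => Γ.surv A n x := by
  refine antitone_nat_of_succ_le fun n => ?_
  induction n generalizing x with
  | zero =>
    by_cases hx : x ∈ A
    · rw [surv, killed_succ_of_mem hx, surv, killed_zero_of_mem hx]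
      refine (hf.avg_mono (g := fun _ => 1) fun y _ => ?_).trans (avg_const 1 x).le
      by_cases hy : y ∈ A <;> simp [killed, hy]
    · simp [surv, killed_of_notMem hx]
  | succ n ih =>
    by_cases hx : x ∈ A
    · rw [surv, killed_succ_of_mem hx, surv, killed_succ_of_mem hx]
      exact hf.avg_mono fun y _ => ih y
    · simp [surv, killed_of_notMem hx]

lemma LocallyFin.surv_le_one (hf : Γ.LocallyFin) (n : ℕ) (x : V) : Γ.surv A n x ≤ 1 :=
  (hf.surv_antitone A x (Nat.zero_le n)).trans (by by_cases hx : x ∈ A <;> simp [surv, killed, hx])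

lemma LocallyFin.killed_eq_sum (hf : Γ.LocallyFin) {F : Finset V} {g : V → ℝ}
    (h : ∀ z ∉ F, g z = 0) (n : ℕ) (x : V) :
    Γ.killed A g n x = ∑ z ∈ F, g z * Γ.kill A n x z := by
  classical
  unfold kill
  rw [← hf.killed_sum]
  congr 1
  ext y
  simp only [Set.indicator_apply, Set.mem_singleton_iff, Pi.one_apply, mul_ite, mul_one, mul_zero,
    Finset.sum_ite_eq]
  split_ifs with hy
  · rfl
  · exact h y hy

lemma LocallyFin.sum_le_killed (hf : Γ.LocallyFin) (F : Finset V) {g : V → ℝ}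
    (h : ∀ z, 0 ≤ g z) (n : ℕ) (x : V) :
    ∑ z ∈ F, g z * Γ.kill A n x z ≤ Γ.killed A g n x := by
  rw [Finset.sum_congr rfl (g := fun z => (F : Set V).indicator g z * Γ.kill A n x z) fun z hz => by
    rw [Set.indicator_of_mem (Finset.mem_coe.2 hz)], ← hf.killed_eq_sum A fun z hz =>
      Set.indicator_of_notMem (by simpa using hz) g]
  exact hf.killed_mono A (fun y => Set.indicator_le_self' (fun _ _ => h _) y) n x

/-- One half of the Chapman–Kolmogorov equation. -/
lemma LocallyFin.sum_kill_mul_le (hf : Γ.LocallyFin) (F : Finset V) (m n : ℕ) (x y : V) :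
    ∑ z ∈ F, Γ.kill A m x z * Γ.kill A n z y ≤ Γ.kill A (m + n) x y := by
  unfold kill
  rw [killed_add_time]
  refine le_trans (le_of_eq ?_) (hf.sum_le_killed A F (killed_nonneg (single_nonneg y) n) m x)
  exact Finset.sum_congr rfl fun z _ => mul_comm _ _

lemma LocallyFin.kill_succ_right (hf : Γ.LocallyFin) (n : ℕ) (x : V) {y : V} (hy : y ∈ A) :
    Γ.kill A (n + 1) x y = ∑ z ∈ (hf y).toFinset, Γ.P z y * Γ.kill A n x z := by
  have h1 : Γ.avg (A.indicator (Set.indicator {y} 1)) = fun z => Γ.P z y := by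
    ext z
    rw [avg, tsum_eq_single y]
    · simp [hy]
    · intro b hb
      simp [hb]
  rw [kill, killed_succ', h1, hf.killed_eq_sum A (F := (hf y).toFinset)]
  intro z hz
  exact Γ.P_eq_zero fun h => hz (by simpa using h.symm)

lemma kill_of_notMem_right {A : Set V} {y : V} (hy : y ∉ A) (n : ℕ) (x : V) :
    Γ.kill A n x y = 0 := by
  induction n generalizing x with
  | zero =>
    by_cases hx : x ∈ A
    · have : x ≠ y := fun h => hy (h ▸ hx)
      simp [kill, killed, this]
    · exact killed_of_notMem hx _ _
  | succ n ih =>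
    unfold kill at *
    by_cases hx : x ∈ A
    · rw [killed_succ_of_mem hx, funext ih, avg_const]
    · exact killed_of_notMem hx _ _

lemma mu_mul_P (x y : V) : Γ.mu x * Γ.P x y = Γ.weight x y := by
  rw [P, mul_div_cancel₀ _ (Γ.mu_pos x).ne']

/-- Reversibility: the first step out of `x` is matched with the last step into `x`
(`kill_succ_right`) through the symmetric weight. -/
lemma LocallyFin.kill_symm (hf : Γ.LocallyFin) (n : ℕ) (x y : V) :
    Γ.mu x * Γ.kill A n x y = Γ.mu y * Γ.kill A n y x := by
  induction n generalizing x with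
  | zero =>
    by_cases h : x = y
    · rw [h]
    · have h' : y ≠ x := fun h' => h h'.symm
      by_cases hx : x ∈ A <;> by_cases hy : y ∈ A <;> simp [kill, killed, hx, hy, h, h']
  | succ n ih =>
    by_cases hx : x ∈ A
    · rw [hf.kill_succ_right A n y hx, kill, killed_succ_of_mem hx, hf.avg_eq_sum, Finset.mul_sum,
        Finset.mul_sum]
      refine Finset.sum_congr rfl fun z _ => ?_
      have := ih z
      rw [← mul_assoc, mu_mul_P, Γ.weight_symm, ← mu_mul_P]
      unfold kill at *
      linear_combination Γ.P z x * this
    · rw [kill_of_notMem_right hx, kill, killed_of_notMem hx, mul_zero, mul_zero]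

end Killed

/-! ### Hitting probabilities within a given time -/

section Hit

open Classical in
variable (Γ) in
/-- The probability `ℙ_w(τ_D ≤ s)` of visiting `D` by time `s`. -/
def hit (D : Set V) : ℕ → V → ℝ
  | 0 => D.indicator 1
  | s + 1 => fun w => if w ∈ D then 1 else Γ.avg (hit D s) w

variable {D : Set V}

lemma hit_of_mem {w : V} (hw : w ∈ D) (s : ℕ) : Γ.hit D s w = 1 := by
  cases s <;> simp [hit, hw]

lemma hit_zero_of_notMem {w : V} (hw : w ∉ D) : Γ.hit D 0 w = 0 := by simp [hit, hw]

lemma hit_succ_of_notMem {w : V} (hw : w ∉ D) (s : ℕ) :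
    Γ.hit D (s + 1) w = Γ.avg (Γ.hit D s) w := by simp [hit, hw]

lemma hit_nonneg (s : ℕ) (w : V) : 0 ≤ Γ.hit D s w := by
  induction s generalizing w with
  | zero => exact Set.indicator_nonneg (fun _ _ => zero_le_one) w
  | succ s ih =>
    by_cases hw : w ∈ D
    · simp [hit_of_mem hw]
    · rw [hit_succ_of_notMem hw]
      exact avg_nonneg ih w

lemma LocallyFin.hit_le_one (hf : Γ.LocallyFin) (s : ℕ) (w : V) : Γ.hit D s w ≤ 1 := by
  induction s generalizing w with
  | zero => by_cases hw : w ∈ D <;> simp [hit, hw]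
  | succ s ih =>
    by_cases hw : w ∈ D
    · simp [hit_of_mem hw]
    · rw [hit_succ_of_notMem hw]
      exact (hf.avg_mono fun y _ => ih y).trans (avg_const 1 w).le

lemma LocallyFin.hit_mono (hf : Γ.LocallyFin) (w : V) : Monotone fun s => Γ.hit D s w := by
  refine monotone_nat_of_le_succ fun s => ?_
  induction s generalizing w with
  | zero =>
    by_cases hw : w ∈ D
    · simp [hit_of_mem hw]
    · rw [hit_zero_of_notMem hw]
      exact hit_nonneg _ _
  | succ s ih =>
    by_cases hw : w ∈ D
    · simp [hit_of_mem hw]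
    · rw [hit_succ_of_notMem hw, hit_succ_of_notMem hw]
      exact hf.avg_mono fun y _ => ih y

/-- The strong Markov property at the first visit to `D'`. -/
lemma LocallyFin.mul_hit_le (hf : Γ.LocallyFin) {D' : Set V} {a : ℝ} (ha : a ≤ 1) {t : ℕ}
    (h : ∀ v ∈ D', a ≤ Γ.hit D t v) (s : ℕ) (w : V) :
    a * Γ.hit D' s w ≤ Γ.hit D (s + t) w := by
  by_cases hw' : w ∈ D'
  · rw [hit_of_mem hw', mul_one]
    exact (h w hw').trans (hf.hit_mono w (Nat.le_add_left t s))
  by_cases hw : w ∈ D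
  · rw [hit_of_mem hw]
    exact mul_le_one₀ ha (hit_nonneg _ _) (hf.hit_le_one _ _)
  induction s generalizing w with
  | zero =>
    rw [hit_zero_of_notMem hw', mul_zero]
    exact hit_nonneg _ _
  | succ s ih =>
    rw [hit_succ_of_notMem hw', Nat.succ_add, hit_succ_of_notMem hw, ← avg_const_mul]
    refine hf.avg_mono fun v _ => ?_
    by_cases hv' : v ∈ D'
    · rw [hit_of_mem hv', mul_one]
      exact (h v hv').trans (hf.hit_mono v (Nat.le_add_left t s))
    by_cases hv : v ∈ D
    · rw [hit_of_mem hv]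
      exact mul_le_one₀ ha (hit_nonneg _ _) (hf.hit_le_one _ _)
    exact ih v hv' hv

end Hit

/-! ### Points on geodesics and finiteness of balls -/

section Dist

variable (Γ) in
lemma exists_between (x y : V) {m : ℕ} (hm : m ≤ Γ.graph.dist x y) :
    ∃ z, Γ.graph.dist x z = m ∧ Γ.graph.dist z y + m = Γ.graph.dist x y := by
  obtain ⟨p, hp⟩ := Γ.connected.exists_walk_length_eq_dist x y
  refine ⟨p.getVert m, ?_⟩
  have h1 := SimpleGraph.dist_le (p.take m)
  have h2 := SimpleGraph.dist_le (p.drop m)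
  have h3 := Γ.connected.dist_triangle (u := x) (v := p.getVert m) (w := y)
  rw [SimpleGraph.Walk.take_length] at h1
  rw [SimpleGraph.Walk.drop_length] at h2
  omega

lemma mem_geod_iff {x y z : V} :
    z ∈ Γ.geod x y ↔ Γ.graph.dist x z + Γ.graph.dist z y = Γ.graph.dist x y := by
  constructor
  · rintro ⟨p, hp, hz⟩
    classical
    have h1 := SimpleGraph.dist_le (p.takeUntil z hz)
    have h2 := SimpleGraph.dist_le (p.dropUntil z hz)
    have h3 := Γ.connected.dist_triangle (u := x) (v := z) (w := y)
    have h4 := congrArg SimpleGraph.Walk.length (p.take_spec hz)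
    rw [SimpleGraph.Walk.length_append] at h4
    omega
  · intro h
    obtain ⟨p, hp⟩ := Γ.connected.exists_walk_length_eq_dist x z
    obtain ⟨q, hq⟩ := Γ.connected.exists_walk_length_eq_dist z y
    refine ⟨p.append q, by rw [SimpleGraph.Walk.length_append]; omega, ?_⟩
    rw [SimpleGraph.Walk.mem_support_append_iff]
    exact .inl p.end_mem_support

lemma LocallyFin.finite_dist_le (hf : Γ.LocallyFin) (x : V) (n : ℕ) :
    {y | Γ.graph.dist x y ≤ n}.Finite := by
  induction n with
  | zero =>
    refine (Set.finite_singleton x).subset fun y hy => ?_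
    have : Γ.graph.dist x y = 0 := Nat.le_zero.1 hy
    exact (Γ.connected.dist_eq_zero_iff.1 this).symm
  | succ n ih =>
    refine (ih.union (ih.biUnion fun z _ => hf z)).subset fun y hy => ?_
    rcases Nat.lt_or_ge n (Γ.graph.dist x y) with h | h
    · obtain ⟨z, hz, hzy⟩ := Γ.exists_between x y h.le
      have hy' : Γ.graph.dist x y ≤ n + 1 := hy
      exact .inr (Set.mem_biUnion (show z ∈ {y | Γ.graph.dist x y ≤ n} from hz.le)
        (SimpleGraph.dist_eq_one_iff_adj.1 (by omega)))
    · exact .inl h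

lemma LocallyFin.finite_ball (hf : Γ.LocallyFin) (x : V) (R : ℝ) : (Γ.ball x R).Finite := by
  refine (hf.finite_dist_le x ⌈R⌉₊).subset fun y hy => ?_
  have : (Γ.graph.dist x y : ℝ) < R := hy
  exact_mod_cast this.le.trans (Nat.le_ceil R)

variable (Γ) in
/-- The closed ball of integer radius. -/
def cball (x : V) (k : ℕ) : Set V := {y | Γ.graph.dist y x ≤ k}

end Dist

end WeightedGraph
end

/-! ### Mean exit times and the on-diagonal bound -/

noncomputable section

namespace WeightedGraph

variable {V : Type*} {Γ : WeightedGraph V}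

lemma P_le_one (x y : V) : Γ.P x y ≤ 1 :=
  (Γ.hasSum_P x).tsum_eq ▸ (Γ.hasSum_P x).summable.le_tsum y fun z _ => Γ.P_nonneg x z

lemma CondP0.exists_le_one (h : Γ.CondP0) :
    ∃ p : ℝ, 0 < p ∧ p ≤ 1 ∧ ∀ x y, Γ.graph.Adj x y → p ≤ Γ.P x y := by
  obtain ⟨p, hp, hP⟩ := h
  have := Γ.infinite
  obtain ⟨x⟩ : Nonempty V := inferInstance
  obtain ⟨y, hy⟩ := Γ.connected.preconnected.exists_adj_of_nontrivial x
  exact ⟨p, hp, (hP x y hy).trans (P_le_one x y), hP⟩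

/-- Exit times from bounded sets with non-empty complement have finite mean. -/
lemma CondP0.summable_surv (h : Γ.CondP0) {U : Set V} {v : V} (hv : v ∉ U) {L : ℕ}
    (hL : ∀ w ∈ U, Γ.graph.dist w v ≤ L) (x : V) : Summable fun n => Γ.surv U n x := by
  have hf := h.locallyFin
  obtain ⟨p, hp, hp1, hP⟩ := h.exists_le_one
  -- With b = ε^dist(·,v), moving one step towards `v` already gives average at least p·b/ε = 2b. So
  -- f = (1 - b)/ε^L satisfies 1 + Pf ≤ f on `U`, and such an f dominates all partial sums of
  -- survival probabilities.
  set ε := p / 2 with hε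
  have hε0 : 0 < ε := by positivity
  have hε1 : ε ≤ 1 := by linarith
  set b : V → ℝ := fun w => ε ^ Γ.graph.dist w v
  have hb0 : ∀ w, 0 ≤ b w := fun w => by positivity
  have hb1 : ∀ w, b w ≤ 1 := fun w => pow_le_one₀ hε0.le hε1
  set f : V → ℝ := fun w => (ε ^ L)⁻¹ * (1 - b w)
  have hf0 : ∀ w, 0 ≤ f w := fun w => mul_nonneg (by positivity) (by linarith [hb1 w])
  have hkey : ∀ w ∈ U, 1 + Γ.avg f w ≤ f w := by
    intro w hw
    have hwv : w ≠ v := fun h => hv (h ▸ hw)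
    have hpos := Γ.connected.pos_dist_of_ne hwv
    obtain ⟨w', h1, h2⟩ := Γ.exists_between w v (m := 1) hpos
    have hadj : Γ.graph.Adj w w' := SimpleGraph.dist_eq_one_iff_adj.1 h1
    have h3 : 2 * b w ≤ Γ.avg b w := by
      refine le_trans ?_ (hf.mul_le_avg hb0 w w')
      have : b w = b w' * ε := by simp only [b]; rw [← h2, pow_succ]
      rw [this]
      have := mul_le_mul_of_nonneg_right (hP w w' hadj) (hb0 w')
      calc 2 * (b w' * ε) = p * b w' := by rw [hε]; ring
        _ ≤ _ := this
    have h4 : ε ^ L ≤ b w := pow_le_pow_of_le_one hε0.le hε1 (hL w hw)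
    have h5 : Γ.avg f w = (ε ^ L)⁻¹ * (1 - Γ.avg b w) := by
      rw [avg_const_mul, hf.avg_sub, avg_const]
    have h6 : 1 ≤ (ε ^ L)⁻¹ * (Γ.avg b w - b w) := by
      rw [inv_mul_eq_div, one_le_div (by positivity)]
      linarith
    rw [h5]
    simp only [f]
    linarith
  have hsum : ∀ N w, ∑ n ∈ Finset.range N, Γ.surv U n w ≤ f w := by
    intro N
    induction N with
    | zero => simpa using hf0
    | succ N ih =>
      intro w
      by_cases hw : w ∈ U
      · rw [Finset.sum_range_succ', surv, killed_zero_of_mem hw, Pi.one_apply, add_comm]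
        refine le_trans ?_ (hkey w hw)
        simp only [surv, killed_succ_of_mem hw]
        rw [← hf.avg_sum]
        gcongr
        exact hf.avg_mono fun y _ => ih y
      · simpa [surv, killed_of_notMem hw] using hf0 w
  exact summable_of_sum_range_le (surv_nonneg U · x) fun N => hsum N x

lemma mem_ball {x y : V} {R : ℝ} : y ∈ Γ.ball x R ↔ (Γ.graph.dist x y : ℝ) < R := Iff.rfl

lemma mem_ball_self {x : V} {R : ℝ} (hR : 0 < R) : x ∈ Γ.ball x R := by simp [mem_ball, hR]

lemma dist_triangle_real (x y z : V) :
    (Γ.graph.dist x z : ℝ) ≤ Γ.graph.dist x y + Γ.graph.dist y z := by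
  exact_mod_cast Γ.connected.dist_triangle

lemma CondP0.summable_surv_ball (h : Γ.CondP0) (z : V) (R : ℝ) (x : V) :
    Summable fun n => Γ.surv (Γ.ball z R) n x := by
  have := Γ.infinite
  obtain ⟨v, hv⟩ := (h.locallyFin.finite_ball z R).exists_notMem
  refine h.summable_surv hv (L := ⌈R⌉₊ + Γ.graph.dist z v) (fun w hw => ?_) x
  have h1 := Γ.connected.dist_triangle (u := w) (v := z) (w := v)
  have h2 : Γ.graph.dist z w ≤ ⌈R⌉₊ := by
    exact_mod_cast (mem_ball.1 hw).le.trans (Nat.le_ceil R)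
  rw [SimpleGraph.dist_comm] at h2
  omega

variable (Γ) in
/-- The real-valued mean exit time `∑_n ℙ_x(T_A > n)`. -/
def mext (A : Set V) (x : V) : ℝ := ∑' n, Γ.surv A n x

lemma mext_nonneg (A : Set V) (x : V) : 0 ≤ Γ.mext A x := tsum_nonneg fun n => surv_nonneg A n x

section Mext

variable {U : Set V}

lemma LocallyFin.mext_eq (hU : ∀ x, Summable fun n => Γ.surv U n x)
    (hf : Γ.LocallyFin) {x : V} (hx : x ∈ U) :
    Γ.mext U x = 1 + Γ.avg (Γ.mext U) x := by
  rw [mext, (hU x).tsum_eq_zero_add, surv, killed_zero_of_mem hx, Pi.one_apply]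
  congr 1
  refine Eq.trans ?_ (hf.hasSum_avg (fun z => (hU z).hasSum) x).tsum_eq
  exact tsum_congr fun n => killed_succ_of_mem hx _ _

lemma sum_surv_le_mext (hU : ∀ x, Summable fun n => Γ.surv U n x)
    (N : ℕ) (x : V) : ∑ n ∈ Finset.range N, Γ.surv U n x ≤ Γ.mext U x :=
  (hU x).sum_le_tsum _ fun n _ => surv_nonneg U n x

/-- Markov's inequality: the first s terms of the series are at least the term at time s. -/
lemma LocallyFin.mul_surv_le_mext (hU : ∀ x, Summable fun n => Γ.surv U n x)
    (hf : Γ.LocallyFin) (s : ℕ) (x : V) :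
    s * Γ.surv U s x ≤ Γ.mext U x := by
  refine le_trans ?_ (sum_surv_le_mext hU s x)
  have := Finset.card_nsmul_le_sum (Finset.range s) (fun n => Γ.surv U n x) (Γ.surv U s x)
    fun n hn => hf.surv_antitone U x (Finset.mem_range.1 hn).le
  simpa using this

/-- Markov property at time m: at most m time units pass before it, and a surviving walk expects at
most `K` more. -/
lemma LocallyFin.mext_le_of_bound (hU : ∀ x, Summable fun n => Γ.surv U n x)
    (hf : Γ.LocallyFin) {K : ℝ} (hK : ∀ w ∈ U, Γ.mext U w ≤ K)
    (m : ℕ) (x : V) : Γ.mext U x ≤ m + K * Γ.surv U m x := by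
  have h1 : ∀ J, ∑ j ∈ Finset.range J, Γ.surv U (j + m) x ≤ K * Γ.surv U m x := by
    intro J
    induction m generalizing x with
    | zero =>
      by_cases hx : x ∈ U
      · rw [show Γ.surv U 0 x = 1 from killed_zero_of_mem hx 1, mul_one]
        exact (sum_surv_le_mext hU J x).trans (hK x hx)
      · simp [surv, killed_of_notMem hx]
    | succ m ih =>
      by_cases hx : x ∈ U
      · simp only [surv, ← add_assoc, killed_succ_of_mem hx]
        rw [← hf.avg_sum, ← avg_const_mul]
        exact hf.avg_mono fun y _ => ih y
      · simp [surv, killed_of_notMem hx]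
  have h2 : ∑' j, Γ.surv U (j + m) x ≤ K * Γ.surv U m x :=
    Real.tsum_le_of_sum_range_le (fun j => surv_nonneg U _ x) h1
  have h3 : ∑ j ∈ Finset.range m, Γ.surv U j x ≤ m := by
    have := Finset.sum_le_card_nsmul (Finset.range m) (fun n => Γ.surv U n x) 1
      fun n _ => hf.surv_le_one U n x
    simpa using this
  rw [mext, ← (hU x).sum_add_tsum_nat_add m]
  linarith

end Mext

lemma LocallyFin.surv_mono_set (hf : Γ.LocallyFin) {A B : Set V} (h : A ⊆ B) (n : ℕ) (x : V) :
    Γ.surv A n x ≤ Γ.surv B n x := by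
  induction n generalizing x with
  | zero => exact Set.indicator_le_indicator_of_subset h (fun _ => zero_le_one) x
  | succ n ih =>
    by_cases hx : x ∈ A
    · rw [surv, surv, killed_succ_of_mem hx, killed_succ_of_mem (h hx)]
      exact hf.avg_mono fun y _ => ih y
    · rw [surv, killed_of_notMem hx]
      exact surv_nonneg B _ x

variable (Γ) in
/-- The real-valued mean exit time from the ball `B(x,R)`, started at its centre. -/
def ER (x : V) (R : ℝ) : ℝ := Γ.mext (Γ.ball x R) x

lemma CondP0.mext_mono (h : Γ.CondP0) {x z : V} {R S : ℝ} (hs : Γ.ball x R ⊆ Γ.ball z S)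
    (y : V) : Γ.mext (Γ.ball x R) y ≤ Γ.mext (Γ.ball z S) y :=
  (h.summable_surv_ball x R y).tsum_le_tsum (fun n => h.locallyFin.surv_mono_set hs n y)
    (h.summable_surv_ball z S y)

lemma CondP0.ER_mono (h : Γ.CondP0) (x : V) : Monotone (Γ.ER x) := fun _ _ hRS =>
  h.mext_mono (fun _ hy => lt_of_lt_of_le (mem_ball.1 hy) hRS) x

lemma CondP0.one_le_ER (h : Γ.CondP0) (x : V) {R : ℝ} (hR : 0 < R) : 1 ≤ Γ.ER x R := by
  have := sum_surv_le_mext (h.summable_surv_ball x R) 1 x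
  rwa [Finset.sum_range_one, surv, killed_zero_of_mem (mem_ball_self hR)] at this

variable (Γ) in
/-- The real-valued form of `(Ē)`, with its constant. -/
def EbarBound (C : ℝ) : Prop :=
  ∀ (x : V) (R : ℝ), 0 < R → ∀ y ∈ Γ.ball x R, Γ.mext (Γ.ball x R) y ≤ C * Γ.ER x R

/-- The mean exit times grow at least like a power of the radius. -/
lemma EbarBound.growth {C : ℝ} (hC : 0 < C) (hE : Γ.EbarBound C) (h : Γ.CondP0) (x : V) {R : ℝ}
    (hR : 1 ≤ R) : (1 + C⁻¹) * Γ.ER x R ≤ Γ.ER x (5 * R) := by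
  have hf := h.locallyFin
  set B := Γ.ball x R
  set f := Γ.mext (Γ.ball x (5 * R))
  set m := C⁻¹ * Γ.ER x R
  -- (Ē) is applied in B(w,3R), which contains B(x,R) and lies inside B(x,5R).
  have hm : ∀ w, (Γ.graph.dist x w : ℝ) ≤ 2 * R → m ≤ f w := by
    intro w hw
    have hw' : (Γ.graph.dist w x : ℝ) ≤ 2 * R := by rwa [SimpleGraph.dist_comm]
    have h1 : Γ.ER x R ≤ Γ.mext (Γ.ball w (3 * R)) x := by
      refine h.mext_mono (fun y hy => ?_) x
      have := mem_ball.1 hy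
      rw [mem_ball]
      linarith [dist_triangle_real (Γ := Γ) w x y]
    have h2 : Γ.mext (Γ.ball w (3 * R)) x ≤ C * Γ.ER w (3 * R) :=
      hE w (3 * R) (by linarith) x (by rw [mem_ball]; linarith)
    have h3 : Γ.ER w (3 * R) ≤ f w := by
      refine h.mext_mono (fun y hy => ?_) w
      have := mem_ball.1 hy
      rw [mem_ball]
      linarith [dist_triangle_real (Γ := Γ) x w y]
    have : m ≤ C⁻¹ * (C * Γ.ER w (3 * R)) :=
      mul_le_mul_of_nonneg_left (h1.trans h2) (by positivity)
    rw [inv_mul_cancel_left₀ hC.ne'] at this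
    linarith
  -- On leaving B(x,R) the walk is still within R + 1 ≤ 2R of `x`, so the expected time left in the
  -- large ball is at least `m`.
  have hs : ∀ N w, (Γ.graph.dist x w : ℝ) ≤ 2 * R →
      ∑ n ∈ Finset.range N, Γ.surv B n w + m ≤ f w := by
    intro N
    induction N with
    | zero => intro w hw; simpa using hm w hw
    | succ N ih =>
      intro w hw
      by_cases hwB : w ∈ B
      · have hw' := mem_ball.1 hwB
        have hw5 : w ∈ Γ.ball x (5 * R) := by rw [mem_ball]; linarith
        simp only [f]
        rw [hf.mext_eq (h.summable_surv_ball x (5 * R)) hw5, Finset.sum_range_succ', surv,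
          killed_zero_of_mem hwB, Pi.one_apply]
        simp only [surv, killed_succ_of_mem hwB]
        rw [← hf.avg_sum]
        have : Γ.avg (fun y => ∑ n ∈ Finset.range N, Γ.killed B 1 n y + m) w ≤ Γ.avg f w := by
          refine hf.avg_mono fun y hy => ih y ?_
          have h1 := dist_triangle_real (Γ := Γ) x w y
          rw [SimpleGraph.dist_eq_one_iff_adj.2 hy] at h1
          push_cast at h1
          linarith
        rw [hf.avg_add, avg_const] at this
        linarith
      · have : ∑ n ∈ Finset.range (N + 1), Γ.surv B n w = 0 :=
          Finset.sum_eq_zero fun n _ => killed_of_notMem hwB _ _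
        rw [this, zero_add]
        exact hm w hw
  have hx : Γ.ER x R ≤ f x - m := by
    refine Real.tsum_le_of_sum_range_le (fun n => surv_nonneg B n x) fun N => ?_
    have := hs N x (by simp; linarith)
    linarith
  have : Γ.ER x (5 * R) = f x := rfl
  rw [this, add_mul, one_mul]
  linarith

lemma LocallyFin.killed_le_univ (hf : Γ.LocallyFin) (A : Set V) {f : V → ℝ} (h : ∀ y, 0 ≤ f y)
    (n : ℕ) (x : V) : Γ.killed A f n x ≤ Γ.killed Set.univ (A.indicator f) n x := by
  have h' : ∀ y, 0 ≤ A.indicator f y := Set.indicator_nonneg fun y _ => h y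
  induction n generalizing x with
  | zero => simp [killed]
  | succ n ih =>
    by_cases hx : x ∈ A
    · rw [killed_succ_of_mem hx, killed_succ_of_mem (Set.mem_univ x)]
      exact hf.avg_mono fun y _ => ih y
    · rw [killed_of_notMem hx]
      exact killed_nonneg h' _ x

lemma LocallyFin.vol_eq_sum (hf : Γ.LocallyFin) (x : V) (R : ℝ) :
    Γ.vol x R = ∑ y ∈ (hf.finite_ball x R).toFinset, Γ.mu y := by
  rw [vol, tsum_subtype (Γ.ball x R) Γ.mu, tsum_eq_sum (s := (hf.finite_ball x R).toFinset)]
  · refine Finset.sum_congr rfl fun y hy => ?_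
    rw [Set.indicator_of_mem (by simpa using hy)]
  · intro y hy
    rw [Set.indicator_of_notMem (by simpa using hy)]

lemma LocallyFin.vol_nonneg (hf : Γ.LocallyFin) (x : V) (R : ℝ) : 0 ≤ Γ.vol x R := by
  rw [hf.vol_eq_sum]
  exact Finset.sum_nonneg fun y _ => (Γ.mu_pos y).le

section Walk

variable [MeasurableSpace V] [DiscreteMeasurableSpace V]

lemma CondP0.meanExit_eq (h : Γ.CondP0) (y x : V) (R : ℝ) :
    Γ.meanExit y (Γ.ball x R) = ENNReal.ofReal (Γ.mext (Γ.ball x R) y) := by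
  rw [h.locallyFin.meanExit_eq, mext,
    ENNReal.ofReal_tsum_of_nonneg (fun n => surv_nonneg _ n y) (h.summable_surv_ball x R y)]
  rfl

lemma CondP0.E_eq (h : Γ.CondP0) (x : V) (R : ℝ) : Γ.E x R = ENNReal.ofReal (Γ.ER x R) :=
  h.meanExit_eq x x R

lemma CondEbar.exists_bound (hE : Γ.CondEbar) (h : Γ.CondP0) : ∃ C, 0 < C ∧ Γ.EbarBound C := by
  obtain ⟨C, hC, hb⟩ := hE
  refine ⟨C, hC, fun x R hR y hy => ?_⟩
  have h1 : Γ.meanExit y (Γ.ball x R) ≤ Γ.Ebar x R :=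
    le_iSup₂ (f := fun y (_ : y ∈ Γ.ball x R) => Γ.meanExit y (Γ.ball x R)) y hy
  have h2 := h1.trans (hb x R hR)
  have h0 : 0 ≤ C * Γ.ER x R := mul_nonneg hC.le (mext_nonneg _ _)
  rw [h.meanExit_eq, h.E_eq, ← ENNReal.ofReal_mul hC.le, ENNReal.ofReal_le_ofReal_iff h0] at h2
  exact h2

lemma LocallyFin.Pn_eq_kill (hf : Γ.LocallyFin) (n : ℕ) (x y : V) :
    Γ.Pn n x y = Γ.kill Set.univ n x y := hf.Pn_eq n x y

lemma LocallyFin.heat_nonneg (hf : Γ.LocallyFin) (n : ℕ) (x y : V) : 0 ≤ Γ.heat n x y :=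
  div_nonneg (hf.Pn_eq_kill n x y ▸ kill_nonneg _ n x y) (Γ.mu_pos y).le

lemma LocallyFin.heat_symm (hf : Γ.LocallyFin) (n : ℕ) (x y : V) :
    Γ.heat n x y = Γ.heat n y x := by
  rw [heat, heat, hf.Pn_eq_kill, hf.Pn_eq_kill, div_eq_div_iff (Γ.mu_pos y).ne' (Γ.mu_pos x).ne']
  linarith [hf.kill_symm Set.univ n x y]

lemma LocallyFin.heat_succ (hf : Γ.LocallyFin) (n : ℕ) (x y : V) :
    Γ.heat (n + 1) x y = Γ.avg (fun z => Γ.heat n z y) x := by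
  simp only [heat, hf.Pn_eq_kill, div_eq_inv_mul]
  rw [avg_const_mul]
  congr 1
  exact killed_succ_of_mem (Set.mem_univ x) _ n

/-- On-diagonal lower bound by the survival probability in a ball. -/
lemma LocallyFin.surv_sq_le (hf : Γ.LocallyFin) (x : V) (R : ℝ) (m : ℕ) :
    Γ.surv (Γ.ball x R) m x ^ 2 ≤ Γ.heat (2 * m) x x * Γ.vol x R := by
  set F := (hf.finite_ball x R).toFinset
  have h1 : Γ.surv (Γ.ball x R) m x ≤ ∑ y ∈ F, Γ.kill Set.univ m x y := by
    refine (hf.killed_le_univ (Γ.ball x R) (f := 1) (fun _ => zero_le_one) m x).trans ?_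
    rw [hf.killed_eq_sum Set.univ (F := F) fun z hz =>
      Set.indicator_of_notMem (by simpa [F] using hz) _]
    refine (Finset.sum_congr rfl fun y hy => ?_).le
    rw [Set.indicator_of_mem (by simpa [F] using hy), Pi.one_apply, one_mul]
  -- Cauchy–Schwarz with weights μ(y); reversibility turns P_m(x,y)²/μ(y) into P_m(x,y)
  -- P_m(y,x)/μ(x).
  have h2 : (∑ y ∈ F, Γ.kill Set.univ m x y) ^ 2 ≤
      (∑ y ∈ F, Γ.kill Set.univ m x y * Γ.kill Set.univ m y x / Γ.mu x) * ∑ y ∈ F, Γ.mu y := by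
    refine Finset.sum_sq_le_sum_mul_sum_of_sq_le_mul F (fun y _ => ?_) (fun y _ => (Γ.mu_pos y).le)
      fun y _ => ?_
    · exact div_nonneg (mul_nonneg (kill_nonneg _ _ _ _) (kill_nonneg _ _ _ _)) (Γ.mu_pos x).le
    · have := hf.kill_symm Set.univ m x y
      refine le_of_eq ?_
      rw [div_mul_eq_mul_div, eq_div_iff (Γ.mu_pos x).ne']
      linear_combination Γ.kill Set.univ m x y * this
  have h3 : ∑ y ∈ F, Γ.kill Set.univ m x y * Γ.kill Set.univ m y x / Γ.mu x
      ≤ Γ.heat (2 * m) x x := by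
    rw [← Finset.sum_div, heat, hf.Pn_eq_kill, two_mul]
    exact div_le_div_of_nonneg_right (hf.sum_kill_mul_le Set.univ F m m x x) (Γ.mu_pos x).le
  rw [hf.vol_eq_sum]
  refine (pow_le_pow_left₀ (surv_nonneg _ _ _) h1 2).trans (h2.trans ?_)
  exact mul_le_mul_of_nonneg_right h3 (Finset.sum_nonneg fun y _ => (Γ.mu_pos y).le)

lemma EbarBound.diagonal {C : ℝ} (hC : 0 < C) (hE : Γ.EbarBound C) (h : Γ.CondP0) (x : V)
    {n j : ℕ} (hj : j + 1 ≤ n) :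
    ((2 * C)⁻¹) ^ 2 / Γ.vol x (Γ.e x n) ≤ Γ.heatTilde j x x := by
  have hf := h.locallyFin
  -- One of j, j + 1 is even, and j + 1 ≤ n keeps it at most n.
  obtain ⟨m, hm, hmn⟩ : ∃ m, (j = 2 * m ∨ j + 1 = 2 * m) ∧ 2 * m ≤ n := by
    rcases Nat.even_or_odd' j with ⟨m, hm | hm⟩
    · exact ⟨m, .inl hm, by omega⟩
    · exact ⟨m + 1, .inr (by omega), by omega⟩
  have h1 : Γ.heat (2 * m) x x ≤ Γ.heatTilde j x x := by
    unfold heatTilde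
    rcases hm with hm | hm <;> rw [hm]
    · linarith [hf.heat_nonneg (2 * m + 1) x x]
    · linarith [hf.heat_nonneg j x x]
  -- If no radius qualifies, `e` is 0 by the convention for `sInf ∅`; the ball is then empty and the
  -- quotient is 0.
  rcases (hf.vol_nonneg x (Γ.e x n)).eq_or_lt with h0 | h0
  · rw [← h0, div_zero]
    exact (hf.heat_nonneg _ x x).trans h1
  refine le_trans ?_ h1
  rw [div_le_iff₀ h0]
  refine le_trans ?_ (hf.surv_sq_le x (Γ.e x n) m)
  refine pow_le_pow_left₀ (by positivity) ?_ 2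
  have he : Γ.e x n ≠ 0 := by
    intro he
    rw [he, hf.vol_eq_sum, Finset.sum_eq_zero] at h0
    · exact lt_irrefl _ h0
    · intro y hy
      have : y ∈ Γ.ball x 0 := by simpa using hy
      exact absurd (mem_ball.1 this) (by simp)
  have hR : (0 : ℝ) < Γ.e x n := by positivity
  have hmem : (n : ℝ) ≤ Γ.ER x (Γ.e x n) := by
    have : Γ.e x n ∈ {r : ℕ | (n : ℝ≥0∞) ≤ Γ.E x r} :=
      Nat.sInf_mem (Nat.nonempty_of_pos_sInf (Nat.pos_of_ne_zero he))
    have h2 : (n : ℝ≥0∞) ≤ Γ.E x (Γ.e x n) := this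
    rw [h.E_eq, ← ENNReal.ofReal_natCast, ENNReal.ofReal_le_ofReal_iff (by exact mext_nonneg _ _)] at h2
    exact h2
  set R : ℝ := (Γ.e x n : ℝ)
  have h2 := hf.mext_le_of_bound (h.summable_surv_ball x R) (hE x R hR) m x
  have h3 : (1 : ℝ) ≤ n := by exact_mod_cast (Nat.succ_le_of_lt (Nat.pos_of_ne_zero (by omega)))
  have h4 : 2 * (m : ℝ) ≤ n := by exact_mod_cast hmn
  have h5 : Γ.mext (Γ.ball x R) x = Γ.ER x R := rfl
  rw [h5] at h2
  have hpos : 0 < Γ.ER x R := by linarith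
  rw [inv_le_iff_one_le_mul₀ (by positivity)]
  -- Survival below 1/(2C) would give E < m + E/2, contradicting 2m ≤ n ≤ E.
  by_contra hc
  push Not at hc
  have : Γ.surv (Γ.ball x R) m x * (2 * C) * Γ.ER x R < 1 * Γ.ER x R :=
    mul_lt_mul_of_pos_right hc hpos
  linarith

/-- Strong Markov property at the first visit to `x`. Since y ≠ x this takes at least one step, so
diagonal bounds at times j < n suffice. -/
lemma LocallyFin.mul_hit_le_heatTilde (hf : Γ.LocallyFin) {x y : V} (hxy : x ≠ y) {n : ℕ} {a : ℝ}
    (h : ∀ j, j + 1 ≤ n → a ≤ Γ.heatTilde j x x) :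
    a * Γ.hit {x} n y ≤ Γ.heatTilde n x y := by
  have hsucc : ∀ j w, Γ.heatTilde (j + 1) w x = Γ.avg (fun z => Γ.heatTilde j z x) w := by
    intro j w
    simp only [heatTilde]
    rw [hf.avg_add, hf.heat_succ, hf.heat_succ]
  have hnn : ∀ j w, 0 ≤ Γ.heatTilde j w x := fun j w =>
    add_nonneg (hf.heat_nonneg _ _ _) (hf.heat_nonneg _ _ _)
  have key : ∀ j, j + 1 ≤ n → ∀ w, a * Γ.hit {x} j w ≤ Γ.heatTilde j w x := by
    intro j
    induction j with
    | zero =>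
      intro hj w
      by_cases hw : w = x
      · subst hw
        rw [hit_of_mem (Set.mem_singleton w), mul_one]
        exact h 0 hj
      · rw [hit_zero_of_notMem (by simpa using hw), mul_zero]
        exact hnn _ _
    | succ j ih =>
      intro hj w
      by_cases hw : w = x
      · subst hw
        rw [hit_of_mem (Set.mem_singleton w), mul_one]
        exact h _ hj
      · rw [hit_succ_of_notMem (by simpa using hw), ← avg_const_mul, hsucc]
        exact hf.avg_mono fun z _ => ih (by omega) z
  have hy : y ∉ ({x} : Set V) := by simpa using hxy.symm
  have hsym : Γ.heatTilde n x y = Γ.heatTilde n y x := by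
    rw [heatTilde, heatTilde, hf.heat_symm n, hf.heat_symm (n + 1)]
  rw [hsym]
  cases n with
  | zero =>
    rw [hit_zero_of_notMem hy, mul_zero]
    exact hnn _ _
  | succ n =>
    rw [hit_succ_of_notMem hy, ← avg_const_mul, hsucc]
    exact hf.avg_mono fun z _ => key n le_rfl z

end Walk

end WeightedGraph
end

/-! ### Green functions of killed walks -/

noncomputable section

namespace WeightedGraph

variable {V : Type*} {Γ : WeightedGraph V}

variable (Γ) in
/-- The Green function `g^U(x,y) = μ(y)⁻¹ ∑_n ℙ_x(X_n = y; T_U > n)`. -/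
def green (U : Set V) (x y : V) : ℝ := ∑' n, Γ.kill U n x y / Γ.mu y

section Green

lemma green_nonneg (U : Set V) (x y : V) : 0 ≤ Γ.green U x y :=
  tsum_nonneg fun n => div_nonneg (kill_nonneg U n x y) (Γ.mu_pos y).le

lemma LocallyFin.green_symm (hf : Γ.LocallyFin) (U : Set V) (x y : V) :
    Γ.green U x y = Γ.green U y x := by
  refine tsum_congr fun n => ?_
  rw [div_eq_div_iff (Γ.mu_pos y).ne' (Γ.mu_pos x).ne']
  linarith [hf.kill_symm U n x y]

lemma green_of_notMem {U : Set V} {x : V} (hx : x ∉ U) (y : V) : Γ.green U x y = 0 := by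
  simp [green, kill, killed_of_notMem hx]

variable {U : Set V}

lemma LocallyFin.summable_kill (hU : ∀ x, Summable fun n => Γ.surv U n x)
    (hf : Γ.LocallyFin) (x y : V) :
    Summable fun n => Γ.kill U n x y / Γ.mu y :=
  (Summable.of_nonneg_of_le (fun n => kill_nonneg U n x y) (fun n => hf.kill_le_surv U n x y)
    (hU x)).div_const _

/-- Off the pole the time-0 term vanishes, so shifting time by one loses nothing. -/
lemma LocallyFin.avg_green (hU : ∀ x, Summable fun n => Γ.surv U n x)
    (hf : Γ.LocallyFin) {x y : V} (hx : x ∈ U) (hxy : x ≠ y) :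
    Γ.avg (fun v => Γ.green U v y) x = Γ.green U x y := by
  have h0 : Γ.kill U 0 x y = 0 := by
    rw [kill, killed_zero_of_mem hx]
    simp [hxy]
  conv_rhs => rw [green, (hf.summable_kill hU x y).tsum_eq_zero_add, h0, zero_div, zero_add]
  refine (hf.hasSum_avg (fun z => (hf.summable_kill hU z y).hasSum) x).tsum_eq.symm.trans ?_
  refine tsum_congr fun n => ?_
  simp only [div_eq_inv_mul]
  rw [avg_const_mul]
  congr 1
  exact (killed_succ_of_mem hx _ n).symm

lemma LocallyFin.harmonicOn_green (hU : ∀ x, Summable fun n => Γ.surv U n x)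
    (hf : Γ.LocallyFin) {y : V} {A : Set V}
    (h : ∀ x ∈ A, x ∈ U ∧ x ≠ y) : Γ.HarmonicOn (fun v => Γ.green U v y) A :=
  fun x hx => hf.avg_green hU (h x hx).1 (h x hx).2

lemma LocallyFin.green_self_pos (hU : ∀ x, Summable fun n => Γ.surv U n x)
    (hf : Γ.LocallyFin) {y : V} (hy : y ∈ U) : 0 < Γ.green U y y := by
  refine (hf.summable_kill hU y y).tsum_pos
    (fun n => div_nonneg (kill_nonneg U n y y) (Γ.mu_pos y).le) 0 ?_
  rw [kill, killed_zero_of_mem hy]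
  simpa using Γ.mu_pos y

lemma LocallyFin.green_pos (hU : ∀ x, Summable fun n => Γ.surv U n x)
    (hf : Γ.LocallyFin) {z w : V}
    (hw : ∀ v, Γ.graph.dist v z ≤ Γ.graph.dist w z → v ∈ U) : 0 < Γ.green U w z := by
  generalize hj : Γ.graph.dist w z = j
  induction j generalizing w with
  | zero =>
    have := Γ.connected.dist_eq_zero_iff.1 hj
    subst this
    exact hf.green_self_pos hU (hw w le_rfl)
  | succ j ih =>
    have hne : w ≠ z := by
      rintro rfl
      simp at hj
    obtain ⟨v, hv, hvz⟩ := Γ.exists_between w z (m := 1) (by omega)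
    have hadj : Γ.graph.Adj w v := SimpleGraph.dist_eq_one_iff_adj.1 hv
    have hpos := ih (w := v) (fun q hq => hw q (by omega)) (by omega)
    rw [← hf.avg_green hU (hw w le_rfl) hne]
    refine lt_of_lt_of_le (mul_pos (div_pos (Γ.weight_pos w v hadj) (Γ.mu_pos w)) hpos)
      (hf.mul_le_avg (fun q => green_nonneg U q z) w v)

/-- Domination of the Green function by hitting and survival probabilities. -/
lemma LocallyFin.green_le_hit_add_surv (hU : ∀ x, Summable fun n => Γ.surv U n x)
    (hf : Γ.LocallyFin) {z : V} {k : ℕ} {M M' : ℝ} (hM' : 0 ≤ M')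
    (hM : 0 ≤ M) (h : ∀ v, Γ.graph.dist v z = k → Γ.green U v z ≤ M)
    (h' : ∀ v, k ≤ Γ.graph.dist v z → Γ.green U v z ≤ M') (s : ℕ) (w : V)
    (hw : k ≤ Γ.graph.dist w z) :
    Γ.green U w z ≤ M * Γ.hit (Γ.cball z k) s w + M' * Γ.surv U s w := by
  have hrest : ∀ s w, 0 ≤ M * Γ.hit (Γ.cball z k) s w + M' * Γ.surv U s w := fun s w =>
    add_nonneg (mul_nonneg hM (hit_nonneg _ _)) (mul_nonneg hM' (surv_nonneg _ _ _))
  induction s generalizing w with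
  | zero =>
    by_cases hwU : w ∈ U
    · rw [show Γ.surv U 0 w = 1 from killed_zero_of_mem hwU 1, mul_one]
      linarith [h' w hw, mul_nonneg hM (hit_nonneg (Γ := Γ) (D := Γ.cball z k) 0 w)]
    · rw [green_of_notMem hwU]
      exact hrest 0 w
  | succ s ih =>
    rcases hw.eq_or_lt with hk | hk
    · rw [hit_of_mem (show w ∈ Γ.cball z k from hk.ge), mul_one]
      linarith [h w hk.symm, mul_nonneg hM' (surv_nonneg (Γ := Γ) U (s + 1) w)]
    by_cases hwU : w ∈ U
    · have hne : w ≠ z := by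
        rintro rfl
        simp at hk
      have hwD : w ∉ Γ.cball z k := fun hc => absurd hk (not_lt.2 hc)
      rw [← hf.avg_green hU hwU hne, hit_succ_of_notMem hwD, surv, killed_succ_of_mem hwU,
        ← avg_const_mul, ← avg_const_mul, ← hf.avg_add]
      -- The distance to `z` exceeds k and changes by at most 1 per step, so the walk cannot jump
      -- over the sphere.
      refine hf.avg_mono fun v hv => ih v ?_
      have h1 := Γ.connected.dist_triangle (u := w) (v := v) (w := z)
      rw [SimpleGraph.dist_eq_one_iff_adj.2 hv] at h1
      omega
    · rw [green_of_notMem hwU]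
      exact hrest _ w

/-- The maximum principle outside a ball around the pole. -/
lemma LocallyFin.green_le_of_sphere (hU : ∀ x, Summable fun n => Γ.surv U n x)
    (hf : Γ.LocallyFin) (hfin : U.Finite) {z : V} {k : ℕ} {M : ℝ}
    (hM : 0 ≤ M) (h : ∀ v, Γ.graph.dist v z = k → Γ.green U v z ≤ M) (w : V)
    (hw : k ≤ Γ.graph.dist w z) : Γ.green U w z ≤ M := by
  -- Any crude global bound will do: its coefficient, the survival probability, tends to 0 as s → ∞.
  set M' := ∑ v ∈ hfin.toFinset, Γ.green U v z
  have hM' : 0 ≤ M' := Finset.sum_nonneg fun v _ => green_nonneg U v z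
  have h' : ∀ v, Γ.green U v z ≤ M' := by
    intro v
    by_cases hv : v ∈ U
    · exact Finset.single_le_sum (f := fun v => Γ.green U v z) (fun v _ => green_nonneg U v z)
        (hfin.mem_toFinset.2 hv)
    · rw [green_of_notMem hv]
      exact hM'
  have hlim : Filter.Tendsto (fun s => M + M' * Γ.surv U s w) Filter.atTop (nhds (M + M' * 0)) :=
    tendsto_const_nhds.add ((hU w).tendsto_atTop_zero.const_mul _)
  rw [mul_zero, add_zero] at hlim
  refine ge_of_tendsto' hlim fun s => ?_
  refine (hf.green_le_hit_add_surv hU hM' hM h (fun v _ => h' v) s w hw).trans ?_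
  gcongr
  exact mul_le_of_le_one_right hM (hf.hit_le_one _ _)

end Green

/-! ### Elliptic Harnack inequality and hitting of balls -/

section Harnack

variable (Γ) in
/-- A form of the elliptic Harnack inequality that includes the trivial comparison of
neighbours. -/
def HarnackBound (C : ℝ) : Prop :=
  ∀ (k : ℕ) (u : V → ℝ) (w w' : V), 1 ≤ k → (∀ v, 0 ≤ u v) → Γ.HarmonicOn u (Γ.ball w k) →
    (Γ.graph.dist w w' ≤ 1 ∨ 2 * Γ.graph.dist w w' < k) → u w' ≤ C * u w

lemma CondH.exists_bound (hH : Γ.CondH) (h : Γ.CondP0) : ∃ C, 1 ≤ C ∧ Γ.HarnackBound C := by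
  obtain ⟨C, hC, hb⟩ := hH
  obtain ⟨p, hp, hp1, hP⟩ := h.exists_le_one
  have hf := h.locallyFin
  refine ⟨max C p⁻¹, (one_le_inv₀ hp |>.2 hp1).trans (le_max_right _ _), ?_⟩
  intro k u w w' hk hu hharm hd
  have hk' : (0 : ℝ) < k := by exact_mod_cast hk
  by_cases h2 : 2 * Γ.graph.dist w w' < k
  · have h2' : 2 * (Γ.graph.dist w w' : ℝ) < k := by exact_mod_cast h2
    have := hb w (k / 2) (by positivity) u (fun z _ => hu z)
      (by rwa [mul_div_cancel₀ _ (two_ne_zero)]) w' (by rw [mem_ball]; linarith) w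
      (mem_ball_self (by positivity))
    exact this.trans (mul_le_mul_of_nonneg_right (le_max_left _ _) (hu w))
  -- For small k the Harnack ball may miss the neighbours of `w`; ellipticity p then supplies the
  -- constant p⁻¹.
  have h1 : Γ.graph.dist w w' = 1 := by omega
  have h3 : p * u w' ≤ u w := by
    rw [← hharm w (mem_ball_self hk')]
    exact (mul_le_mul_of_nonneg_right (hP w w' (SimpleGraph.dist_eq_one_iff_adj.1 h1))
      (hu w')).trans (hf.mul_le_avg hu w w')
  calc u w' = p⁻¹ * (p * u w') := by rw [inv_mul_cancel_left₀ hp.ne']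
    _ ≤ p⁻¹ * u w := mul_le_mul_of_nonneg_left h3 (by positivity)
    _ ≤ _ := mul_le_mul_of_nonneg_right (le_max_right _ _) (hu w)

lemma HarnackBound.chain {C : ℝ} (hC : 1 ≤ C) (hH : Γ.HarnackBound C) {k : ℕ} (hk : 1 ≤ k)
    {u : V → ℝ} (hu : ∀ v, 0 ≤ u v) (i : ℕ) {w w' : V}
    (h : ∀ v, Γ.graph.dist w v + Γ.graph.dist v w' = Γ.graph.dist w w' →
      Γ.HarmonicOn u (Γ.ball v k))
    (hi : Γ.graph.dist w w' ≤ i * max 1 (k / 4)) : u w' ≤ C ^ i * u w := by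
  induction i generalizing w with
  | zero =>
    have : w = w' := Γ.connected.dist_eq_zero_iff.1 (by omega)
    rw [this, pow_zero, one_mul]
  | succ i ih =>
    -- A hop of this length is either a single edge or shorter than k/2, so one application of
    -- `HarnackBound` covers it.
    set t := max 1 (k / 4) with ht
    obtain ⟨v, hv, hvw⟩ := Γ.exists_between w w' (min_le_right t (Γ.graph.dist w w'))
    have h1 : u v ≤ C * u w := by
      refine hH k u w v hk hu (h w (by simp)) ?_
      omega
    have h2 : u w' ≤ C ^ i * u v := by
      refine ih (fun q hq => h q ?_) ?_
      · have h3 := Γ.connected.dist_triangle (u := w) (v := v) (w := q)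
        have h4 := Γ.connected.dist_triangle (u := w) (v := q) (w := w')
        omega
      · rw [Nat.succ_mul] at hi
        generalize i * t = a at *
        omega
    calc u w' ≤ C ^ i * u v := h2
      _ ≤ C ^ i * (C * u w) := mul_le_mul_of_nonneg_left h1 (by positivity)
      _ = _ := by ring

/-- The Green function is comparable to a constant on spheres around its pole. -/
lemma HarnackBound.green_sphere {C : ℝ} (hC : 1 ≤ C) (hH : Γ.HarnackBound C) (hf : Γ.LocallyFin)
    {U : Set V} (hU : ∀ x, Summable fun n => Γ.surv U n x) {z : V} {k : ℕ} (hk : 1 ≤ k)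
    (hz : ∀ q, Γ.graph.dist z q < 2 * k → q ∈ U) {x y : V} (hx : Γ.graph.dist z x = k)
    (hy : Γ.graph.dist z y = k) : Γ.green U x z ≤ C ^ 56 * Γ.green U y z := by
  have near : 2 * Γ.graph.dist y x < k → Γ.green U x z ≤ C ^ 56 * Γ.green U y z := by
    intro hxy
    have := hH k (fun v => Γ.green U v z) y x hk (fun v => green_nonneg U v z)
      (hf.harmonicOn_green hU fun q hq => by
        have hq' : Γ.graph.dist y q < k := by exact_mod_cast mem_ball.1 hq
        have h1 := Γ.connected.dist_triangle (u := z) (v := y) (w := q)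
        refine ⟨hz q (by omega), ?_⟩
        rintro rfl
        rw [SimpleGraph.dist_comm] at hq'
        omega) (.inr hxy)
    exact this.trans (mul_le_mul_of_nonneg_right (le_self_pow₀ hC (by norm_num))
      (green_nonneg U y z))
  -- If a geodesic from `z` to one of the points passes within k/4 of the other, then d(x,y) < k/2
  -- and one Harnack step away from the pole suffices.
  by_cases hA : ∃ p, Γ.graph.dist z p + Γ.graph.dist p x = k ∧ 4 * Γ.graph.dist p y < k
  · obtain ⟨p, hp, hpy⟩ := hA
    refine near ?_
    have h1 := Γ.connected.dist_triangle (u := z) (v := p) (w := y)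
    have h2 := Γ.connected.dist_triangle (u := y) (v := p) (w := x)
    rw [Γ.graph.dist_comm (u := y) (v := p)] at h2
    omega
  by_cases hB : ∃ p, Γ.graph.dist z p + Γ.graph.dist p y = k ∧ 4 * Γ.graph.dist p x < k
  · obtain ⟨p, hp, hpx⟩ := hB
    refine near ?_
    have h1 := Γ.connected.dist_triangle (u := z) (v := p) (w := x)
    have h2 := Γ.connected.dist_triangle (u := y) (v := p) (w := x)
    rw [Γ.graph.dist_comm (u := y) (v := p)] at h2
    omega
  push Not at hA hB
  -- Otherwise balls of radius ⌈k/4⌉ along each geodesic avoid the other point. The pole is moved by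
  -- symmetry: g(x,z) = g(z,x) ≲ g(y,x) = g(x,y) ≲ g(z,y). Length k in hops of `max 1 (j / 4)` takes
  -- at most 28 of them.
  set j := (k + 3) / 4
  have harm : ∀ p a, Γ.graph.dist z p ≤ k → k ≤ 4 * Γ.graph.dist p a →
      Γ.HarmonicOn (fun v => Γ.green U v a) (Γ.ball p j) := by
    intro p a hzp hpa
    refine hf.harmonicOn_green hU fun q hq => ?_
    have hq' : Γ.graph.dist p q < j := by exact_mod_cast mem_ball.1 hq
    have h1 := Γ.connected.dist_triangle (u := z) (v := p) (w := q)
    refine ⟨hz q (by omega), ?_⟩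
    rintro rfl
    omega
  have h1 : Γ.green U x y ≤ C ^ 28 * Γ.green U z y := by
    refine hH.chain hC (u := fun v => Γ.green U v y) (k := j) (by omega)
      (fun v => green_nonneg U v y) 28 (fun p hp => ?_) (by omega)
    exact harm p y (by omega) (hA p (by omega))
  have h2 : Γ.green U z x ≤ C ^ 28 * Γ.green U y x := by
    refine hH.chain hC (u := fun v => Γ.green U v x) (k := j) (by omega)
      (fun v => green_nonneg U v x) 28 (fun p hp => ?_) ?_
    · rw [Γ.graph.dist_comm (u := y) (v := p), Γ.graph.dist_comm (u := p) (v := z),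
        Γ.graph.dist_comm (u := y) (v := z)] at hp
      exact harm p x (by omega) (hB p (by omega))
    · rw [SimpleGraph.dist_comm]
      omega
  calc Γ.green U x z = Γ.green U z x := hf.green_symm U x z
    _ ≤ C ^ 28 * Γ.green U y x := h2
    _ = C ^ 28 * Γ.green U x y := by rw [hf.green_symm U y x]
    _ ≤ C ^ 28 * (C ^ 28 * Γ.green U z y) := mul_le_mul_of_nonneg_left h1 (by positivity)
    _ = C ^ 56 * Γ.green U y z := by rw [hf.green_symm U z y]; ring

variable (Γ) in
/-- Hitting `B(z,k)` from `B(z,9k)` within a time of order `E(z,10k)` has probability at least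
`c`. -/
def HitBound (c K : ℝ) : Prop :=
  ∀ (z w : V) (k s : ℕ), 1 ≤ k → Γ.graph.dist w z ≤ 9 * k → K * Γ.ER z (10 * k) ≤ s →
    c ≤ Γ.hit (Γ.cball z k) s w

lemma HarnackBound.exists_hitBound {C CE : ℝ} (hC : 1 ≤ C) (hH : Γ.HarnackBound C) (hCE : 0 < CE)
    (hE : Γ.EbarBound CE) (h : Γ.CondP0) : ∃ c K, 0 < c ∧ c ≤ 1 ∧ 0 < K ∧ Γ.HitBound c K := by
  have hf := h.locallyFin
  -- One factor C^56 leads from `w` radially to the sphere of radius k (length at most 8k), another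
  -- compares points on that sphere.
  set A := C ^ 112 with hA
  have hA1 : 1 ≤ A := one_le_pow₀ hC
  refine ⟨(2 * A)⁻¹, 2 * A * CE, by positivity, inv_le_one_of_one_le₀ (by linarith),
    by positivity, ?_⟩
  intro z w k s hk hw hs
  by_cases hwk : Γ.graph.dist w z ≤ k
  · rw [hit_of_mem (show w ∈ Γ.cball z k from hwk)]
    exact inv_le_one_of_one_le₀ (by linarith)
  push Not at hwk
  have hk' : (0 : ℝ) < k := by exact_mod_cast hk
  set U := Γ.ball z (10 * k) with hUdef
  have hU : ∀ x, Summable fun n => Γ.surv U n x := h.summable_surv_ball z (10 * k)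
  have hmem : ∀ q, Γ.graph.dist z q < 10 * k → q ∈ U := fun q hq => by
    rw [hUdef, mem_ball]
    exact_mod_cast hq
  have hpos : 0 < Γ.green U w z := hf.green_pos hU fun v hv => hmem v (by
    rw [SimpleGraph.dist_comm]
    omega)
  obtain ⟨w', h1, h2⟩ := Γ.exists_between w z (m := Γ.graph.dist w z - k) (by omega)
  have h3 : Γ.green U w' z ≤ C ^ 56 * Γ.green U w z := by
    refine hH.chain hC hk (u := fun v => Γ.green U v z) (fun v => green_nonneg U v z) 56
      (fun v hv => ?_) (by omega)
    refine hf.harmonicOn_green hU fun q hq => ?_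
    have hq' : Γ.graph.dist v q < k := by exact_mod_cast mem_ball.1 hq
    have t1 := Γ.connected.dist_triangle (u := w) (v := v) (w := z)
    have t2 := Γ.connected.dist_triangle (u := v) (v := w') (w := z)
    have t3 := Γ.connected.dist_triangle (u := z) (v := v) (w := q)
    rw [Γ.graph.dist_comm (u := z) (v := v)] at t3
    refine ⟨hmem q (by omega), ?_⟩
    rintro rfl
    omega
  have h4 : ∀ v, Γ.graph.dist v z = k → Γ.green U v z ≤ A * Γ.green U w z := by
    intro v hv
    have := hH.green_sphere hC hf hU hk (fun q hq => hmem q (by omega))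
      (by rw [SimpleGraph.dist_comm]; exact hv)
      (by rw [SimpleGraph.dist_comm]; omega : Γ.graph.dist z w' = k)
    calc _ ≤ _ := this
      _ ≤ C ^ 56 * (C ^ 56 * Γ.green U w z) := mul_le_mul_of_nonneg_left h3 (by positivity)
      _ = _ := by rw [hA]; ring
  have hM : 0 ≤ A * Γ.green U w z := by positivity
  have h5 := hf.green_le_hit_add_surv hU hM hM h4
    (hf.green_le_of_sphere hU (hf.finite_ball z _) hM h4) s w hwk.le
  -- Both bounds on g are the same multiple of g(w), which is positive and cancels.
  have h6 : 1 ≤ A * (Γ.hit (Γ.cball z k) s w + Γ.surv U s w) := by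
    have : 1 * Γ.green U w z ≤ A * (Γ.hit (Γ.cball z k) s w + Γ.surv U s w) * Γ.green U w z := by
      linarith
    exact le_of_mul_le_mul_right this hpos
  have h7 : s * Γ.surv U s w ≤ CE * Γ.ER z (10 * k) :=
    (hf.mul_surv_le_mext hU s w).trans (hE z _ (by positivity) w (hmem w (by
      rw [SimpleGraph.dist_comm]; omega)))
  have hER := h.one_le_ER z (R := 10 * k) (by positivity)
  have hs0 : (0 : ℝ) < s := lt_of_lt_of_le (mul_pos (by positivity) (by linarith)) hs
  have h8 : 2 * A * Γ.surv U s w ≤ 1 := by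
    have : s * (2 * A * Γ.surv U s w) ≤ s * 1 := by
      calc s * (2 * A * Γ.surv U s w) = 2 * A * (s * Γ.surv U s w) := by ring
        _ ≤ 2 * A * (CE * Γ.ER z (10 * k)) := mul_le_mul_of_nonneg_left h7 (by positivity)
        _ = 2 * A * CE * Γ.ER z (10 * k) := by ring
        _ ≤ s * 1 := by rw [mul_one]; exact hs
    exact le_of_mul_le_mul_left this hs0
  rw [inv_le_iff_one_le_mul₀ (by positivity)]
  linarith

end Harnack

end WeightedGraph
end

/-! ### Hitting a point: shrinking balls, then chaining along a geodesic -/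

noncomputable section

namespace WeightedGraph

variable {V : Type*} {Γ : WeightedGraph V}

lemma LocallyFin.pow_dist_le_hit (hf : Γ.LocallyFin) {p : ℝ} (hp : 0 ≤ p)
    (hP : ∀ x y, Γ.graph.Adj x y → p ≤ Γ.P x y) (x : V) {t : ℕ} {w : V}
    (ht : Γ.graph.dist w x ≤ t) : p ^ Γ.graph.dist w x ≤ Γ.hit {x} t w := by
  induction t generalizing w with
  | zero =>
    have : w = x := Γ.connected.dist_eq_zero_iff.1 (Nat.le_zero.1 ht)
    subst this
    simp [hit_of_mem]
  | succ t ih =>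
    by_cases hw : w = x
    · subst hw
      simp [hit_of_mem]
    have hpos := Γ.connected.pos_dist_of_ne hw
    obtain ⟨v, hv, hvx⟩ := Γ.exists_between w x (m := 1) hpos
    rw [hit_succ_of_notMem (by simpa using hw), ← hvx, pow_succ']
    refine le_trans ?_ (hf.mul_le_avg (hit_nonneg t) w v)
    exact mul_le_mul (hP w v (SimpleGraph.dist_eq_one_iff_adj.1 hv)) (ih (by omega))
      (by positivity) (Γ.P_nonneg w v)

variable (Γ) in
/-- Hitting the centre of `B(x,k)` within a time of order `E(x,5k)` has probability at least
`c k^{-D}`. -/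
def PointHitBound (c K : ℝ) (D : ℕ) : Prop :=
  ∀ (x w : V) (k t : ℕ), 1 ≤ k → Γ.graph.dist w x ≤ k → K * Γ.ER x (5 * k) ≤ t →
    c * ((k : ℝ) ^ D)⁻¹ ≤ Γ.hit {x} t w

lemma HitBound.exists_pointHitBound {c K CE : ℝ} (hc : 0 < c) (hK : 0 < K)
    (hhit : Γ.HitBound c K) (hCE : 0 < CE) (hE : Γ.EbarBound CE) (h : Γ.CondP0) :
    ∃ c' K' D, 0 < c' ∧ c' ≤ 1 ∧ 0 < K' ∧ 0 < D ∧ Γ.PointHitBound c' K' D := by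
  have hf := h.locallyFin
  obtain ⟨p, hp, hp1, hP⟩ := h.exists_le_one
  -- One passage from radius k to ⌊k/5⌋ costs `c`, which the exponent must cover; below it is raised
  -- to D + 1 so that it is positive.
  obtain ⟨D, hD⟩ := exists_pow_lt_of_lt_one hc (show (5⁻¹ : ℝ) < 1 by norm_num)
  have hD' : (5⁻¹ : ℝ) ^ (D + 1) ≤ c :=
    (pow_le_pow_of_le_one (by norm_num) (by norm_num) (Nat.le_succ D)).trans hD.le
  have hK' : 4 ≤ (K + 4) * (1 + CE) := by nlinarith
  have hp4 : p ^ 4 ≤ 1 := pow_le_one₀ hp.le hp1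
  -- p^4 pays for k < 5, where at most four steps are needed. The time constant K' satisfies K + 2 +
  -- K' CE/(1 + CE) ≤ K': one passage, two roundings (absorbed since E ≥ 1), and the remaining
  -- scales, by growth of E.
  refine ⟨p ^ 4, (K + 4) * (1 + CE), D + 1, by positivity, hp4, by linarith, D.succ_pos, ?_⟩
  intro x w k
  induction k using Nat.strong_induction_on generalizing w with
  | _ k ih =>
    intro t hk hw ht
    have hk0 : (0 : ℝ) < k := by exact_mod_cast hk
    have hk1 : (1 : ℝ) ≤ k := by exact_mod_cast hk
    have hER := h.one_le_ER x (R := 5 * k) (by positivity)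
    by_cases hk5 : k < 5
    · have ht4 : 4 ≤ t := by
        have : (4 : ℝ) ≤ t := by nlinarith
        exact_mod_cast this
      calc p ^ 4 * ((k : ℝ) ^ (D + 1))⁻¹ ≤ p ^ 4 :=
            mul_le_of_le_one_right (by positivity) (inv_le_one_of_one_le₀ (one_le_pow₀ hk1))
        _ ≤ p ^ Γ.graph.dist w x := pow_le_pow_of_le_one hp.le hp1 (by omega)
        _ ≤ _ := hf.pow_dist_le_hit hp.le hP x (by omega)
    set j := k / 5 with hj
    have hj1 : 1 ≤ j := by omega
    have hj0 : (0 : ℝ) < j := by exact_mod_cast hj1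
    have hjk : 5 * (j : ℝ) ≤ k := by exact_mod_cast (show 5 * j ≤ k by omega)
    have hE1 : Γ.ER x (10 * j) ≤ Γ.ER x (5 * k) := h.ER_mono x (by linarith)
    have hE2 : Γ.ER x (5 * j) ≤ Γ.ER x k := h.ER_mono x hjk
    have hE3 := hE.growth hCE h x hk1
    have hE4 : (1 + CE) * Γ.ER x k ≤ CE * Γ.ER x (5 * k) := by
      have := mul_le_mul_of_nonneg_left hE3 hCE.le
      rw [← mul_assoc, mul_add, mul_inv_cancel₀ hCE.ne', mul_one] at this
      linarith
    set a := ⌈K * Γ.ER x (10 * j)⌉₊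
    set b := ⌈(K + 4) * (1 + CE) * Γ.ER x (5 * j)⌉₊
    have ha : (a : ℝ) ≤ K * Γ.ER x (10 * j) + 1 :=
      (Nat.ceil_lt_add_one (mul_nonneg hK.le (mext_nonneg _ _))).le
    have hb : (b : ℝ) ≤ (K + 4) * (1 + CE) * Γ.ER x (5 * j) + 1 :=
      (Nat.ceil_lt_add_one (mul_nonneg (by linarith) (mext_nonneg _ _))).le
    have hab : a + b ≤ t := by
      have h1 : K * Γ.ER x (10 * j) ≤ K * Γ.ER x (5 * k) := mul_le_mul_of_nonneg_left hE1 hK.le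
      have h2 : (K + 4) * ((1 + CE) * Γ.ER x (5 * j)) ≤ (K + 4) * (CE * Γ.ER x (5 * k)) :=
        mul_le_mul_of_nonneg_left
          ((mul_le_mul_of_nonneg_left hE2 (by linarith)).trans hE4) (by linarith)
      have : (a : ℝ) + b ≤ t := by linarith
      exact_mod_cast this
    set q := p ^ 4 * ((j : ℝ) ^ (D + 1))⁻¹
    have hq0 : 0 ≤ q := by positivity
    have hq1 : q ≤ 1 := mul_le_one₀ hp4 (by positivity)
      (inv_le_one_of_one_le₀ (one_le_pow₀ (by exact_mod_cast hj1)))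
    have hstep := hf.mul_hit_le hq1 (D := {x}) (D' := Γ.cball x j) (t := b)
      (fun v hv => ih j (by omega) v b hj1 hv (Nat.le_ceil _)) a w
    -- Here k ≤ 5j + 4 ≤ 9j, which is why `HitBound` reaches out to 9k.
    have hfirst : c ≤ Γ.hit (Γ.cball x j) a w := hhit x w j a hj1 (by omega) (Nat.le_ceil _)
    calc p ^ 4 * ((k : ℝ) ^ (D + 1))⁻¹ ≤ p ^ 4 * ((5 * (j : ℝ)) ^ (D + 1))⁻¹ := by gcongr
      _ = q * 5⁻¹ ^ (D + 1) := by simp only [q, mul_pow, mul_inv, inv_pow]; ring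
      _ ≤ q * c := mul_le_mul_of_nonneg_left hD' hq0
      _ ≤ q * Γ.hit (Γ.cball x j) a w := mul_le_mul_of_nonneg_left hfirst hq0
      _ ≤ Γ.hit {x} (a + b) w := hstep
      _ ≤ Γ.hit {x} t w := hf.hit_mono w hab

/-- Following a geodesic by a chain of balls. -/
lemma HitBound.chain {c K : ℝ} (hc : 0 < c) (hc1 : c ≤ 1) (hhit : Γ.HitBound c K)
    (hf : Γ.LocallyFin) {x y : V} {k s t : ℕ} (hk : 1 ≤ k) {a : ℝ} (ha : 0 ≤ a) (ha1 : a ≤ 1)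
    (hs : ∀ z ∈ Γ.geod x y, K * Γ.ER z (10 * k) ≤ s)
    (ht : ∀ v, Γ.graph.dist v x ≤ k → a ≤ Γ.hit {x} t v) (i : ℕ) {z w : V}
    (hz : z ∈ Γ.geod x y) (hzx : Γ.graph.dist z x ≤ i * k) (hw : Γ.graph.dist w z ≤ k) :
    a * c ^ i ≤ Γ.hit {x} (i * s + t) w := by
  induction i generalizing z w with
  | zero =>
    have : z = x := Γ.connected.dist_eq_zero_iff.1 (by omega)
    subst this
    simpa using ht w hw
  | succ i ih =>
    obtain ⟨v, hv, hvx⟩ := Γ.exists_between z x (min_le_right k (Γ.graph.dist z x))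
    have hvg : v ∈ Γ.geod x y := by
      rw [mem_geod_iff] at hz ⊢
      have h1 := Γ.connected.dist_triangle (u := x) (v := v) (w := y)
      have h2 := Γ.connected.dist_triangle (u := v) (v := z) (w := y)
      rw [Γ.graph.dist_comm (u := v) (v := z)] at h2
      rw [Γ.graph.dist_comm (u := z) (v := x), Γ.graph.dist_comm (u := v) (v := x)] at *
      omega
    have hvi : Γ.graph.dist v x ≤ i * k := by
      rw [Nat.succ_mul] at hzx
      generalize i * k = b at *
      omega
    -- In fact 2k: the walk is somewhere in the ball around `z`, and the next centre is at most k
    -- further on.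
    have hwv : Γ.graph.dist w v ≤ 9 * k := by
      have := Γ.connected.dist_triangle (u := w) (v := z) (w := v)
      omega
    have h1 := hf.mul_hit_le (mul_le_one₀ ha1 (by positivity) (pow_le_one₀ hc.le hc1))
      (D' := Γ.cball v k) (fun q hq => ih hvg hvi hq) s w
    have h2 := mul_le_mul_of_nonneg_left (hhit v w k s hk hwv (hs v hvg))
      (show 0 ≤ a * c ^ i by positivity)
    rw [show (i + 1) * s + t = s + (i * s + t) by ring, pow_succ, ← mul_assoc]
    exact h2.trans h1

/-- For r = d/(3l) below 1 the factor r^(-D) is large, but at most (3l)^D ≤ exp(3Dl), so the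
exponential absorbs it. -/
lemma inv_pow_mul_exp_le {d l C L : ℝ} {D : ℕ} (hd : 1 ≤ d) (hl : 0 < l)
    (hC : 3 * D + 3 * L ≤ C) :
    ((d / (3 * l)) ^ D)⁻¹ * Real.exp (-C * l) ≤ Real.exp (-(3 * L * l)) := by
  have h1 : ((d / (3 * l)) ^ D)⁻¹ ≤ Real.exp (3 * l) ^ D := by
    rw [← inv_pow, inv_div]
    refine pow_le_pow_left₀ (by positivity) ?_ D
    calc 3 * l / d ≤ 3 * l := div_le_self (by positivity) hd
      _ ≤ Real.exp (3 * l) := by linarith [Real.add_one_le_exp (3 * l)]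
  calc _ ≤ Real.exp (3 * l) ^ D * Real.exp (-C * l) :=
        mul_le_mul_of_nonneg_right h1 (Real.exp_pos _).le
    _ = Real.exp (D * (3 * l) + -C * l) := by rw [← Real.exp_nat_mul, ← Real.exp_add]
    _ ≤ _ := Real.exp_le_exp.2 (by nlinarith)

section Walk

variable [MeasurableSpace V] [DiscreteMeasurableSpace V]

lemma CondP0.mul_ER_le_of_mem_chainSet (h : Γ.CondP0) {Q C R b : ℝ} (hQ : 0 ≤ Q) (hb : 0 ≤ b)
    {x y z : V} {m : ℕ} (hm : m ∈ Γ.chainSet Q C x y b R) (hz : z ∈ Γ.geod x y) :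
    Q * Γ.ER z (C * R / m) ≤ b / m := by
  have h1 : Γ.E z (C * R / m) ≤ ⨆ z ∈ Γ.geod x y, Γ.E z (C * R / m) :=
    le_iSup₂ (f := fun z (_ : z ∈ Γ.geod x y) => Γ.E z (C * R / m)) z hz
  have h2 := (mul_le_mul_right h1 (ENNReal.ofReal Q)).trans hm.2
  rwa [h.E_eq, ← ENNReal.ofReal_mul hQ, ENNReal.ofReal_le_ofReal_iff (by positivity)] at h2

/-- The lower bound for the probability of reaching `x` from `y` by time `n`. -/
lemma CondP0.exists_hit_lower_bound (h : Γ.CondP0) (hE : Γ.CondEbar) (hH : Γ.CondH) :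
    ∃ Q₀ c C : ℝ, ∃ D : ℕ, 0 < Q₀ ∧ 0 < c ∧ 0 < C ∧ 0 < D ∧ ∀ Q, Q₀ ≤ Q →
      ∀ (x y : V) (n : ℕ), x ≠ y → Γ.graph.dist x y ≤ n →
        ∀ d l : ℝ, d = Γ.graph.dist x y → l = Γ.chainLength Q 9 x y ((n : ℝ) / 2) d →
          0 < l ∧ c * (((d / (3 * l)) ^ D)⁻¹ * Real.exp (-C * l)) ≤ Γ.hit {x} n y := by
  have hf := h.locallyFin
  obtain ⟨p, hp, hp1, hP⟩ := h.exists_le_one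
  obtain ⟨CE, hCE, hE⟩ := hE.exists_bound h
  obtain ⟨CH, hCH, hH⟩ := hH.exists_bound h
  obtain ⟨c₁, K₁, hc₁, hc₁1, hK₁, hhit⟩ := hH.exists_hitBound hCH hCE hE h
  obtain ⟨c₂, K₂, D, hc₂, hc₂1, hK₂, hD, hpoint⟩ := hhit.exists_pointHitBound hc₁ hK₁ hCE hE h
  set L := -Real.log p
  set M := -Real.log c₁
  have hL : 0 ≤ L := neg_nonneg.2 (Real.log_nonpos hp.le hp1)
  have hM : 0 ≤ M := neg_nonneg.2 (Real.log_nonpos hc₁.le hc₁1)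
  have hpL : Real.exp (-L) = p := by rw [neg_neg, Real.exp_log hp]
  have hcM : Real.exp (-M) = c₁ := by rw [neg_neg, Real.exp_log hc₁]
  have hDr : (0 : ℝ) < D := by exact_mod_cast hD
  -- `Q₀` serves two time budgets: 6m chain steps share n/2, and the final approach to `x` has the
  -- other n/2; the extra units pay for rounding down. In the exponent, 3D + 3L is for r ≤ 1 and 6M
  -- for the chain.
  refine ⟨6 * (K₁ + 1) + K₂ + 1, c₂, 3 * D + 3 * L + 6 * M, D, by positivity, hc₂,
    by positivity, hD, ?_⟩
  intro Q hQ x y n hxy hn d l hd hl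
  have hdist := Γ.connected.pos_dist_of_ne hxy
  have hd1 : 1 ≤ d := by rw [hd]; exact_mod_cast hdist
  have hd0 : 0 < d := by linarith
  have hlcases : l = d ∨ ∃ m : ℕ, l = m ∧ 0 < m ∧ m ∈ Γ.chainSet Q 9 x y ((n : ℝ) / 2) d := by
    rw [chainLength] at hl
    split_ifs at hl with hne
    · exact .inr ⟨_, hl, (Nat.sInf_mem hne).1, Nat.sInf_mem hne⟩
    · exact .inl hl
  have hl0 : 0 < l := by
    rcases hlcases with h1 | ⟨m, h1, h2, -⟩ <;> rw [h1]
    · exact hd0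
    · exact_mod_cast h2
  refine ⟨hl0, ?_⟩
  rcases le_or_gt d (3 * l) with hdl | hdl
  · have h1 := inv_pow_mul_exp_le (D := D) (L := L) (C := 3 * D + 3 * L + 6 * M) hd1 hl0
      (by linarith)
    calc _ ≤ 1 * Real.exp (-(3 * L * l)) := mul_le_mul hc₂1 h1 (by positivity) zero_le_one
      _ ≤ Real.exp (Γ.graph.dist x y * -L) := by
        rw [one_mul, ← hd]
        exact Real.exp_le_exp.2 (by nlinarith)
      _ = p ^ Γ.graph.dist y x := by rw [Real.exp_nat_mul, hpL, SimpleGraph.dist_comm]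
      _ ≤ _ := hf.pow_dist_le_hit hp.le hP x (by rwa [SimpleGraph.dist_comm])
  -- The fallback value l = d is incompatible with d > 3l.
  obtain ⟨m, hlm, hm0, hm⟩ := hlcases.resolve_left (by intro h1; linarith)
  have hQ0 : 0 < Q := by linarith
  set r := d / (3 * l) with hr
  have hr1 : 1 < r := by rw [hr, one_lt_div (by positivity)]; exact hdl
  have hdr : d = 3 * l * r := by rw [hr]; field_simp
  set k := ⌊r⌋₊
  have hk1 : 1 ≤ k := Nat.le_floor (by exact_mod_cast hr1.le)
  have hkr : (k : ℝ) ≤ r := Nat.floor_le (by linarith)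
  have hkr' : r < k + 1 := Nat.lt_floor_add_one r
  have hk1' : (1 : ℝ) ≤ k := by exact_mod_cast hk1
  -- The radius controlled by `chainSet` dominates both 10k and 5k, as k ≤ r.
  have hrad : 9 * d / (m : ℝ) = 27 * r := by rw [← hlm, hdr]; field_simp; norm_num
  have hbase : ∀ z ∈ Γ.geod x y, Q * Γ.ER z (27 * r) ≤ n / (2 * l) := by
    intro z hz
    have := h.mul_ER_le_of_mem_chainSet hQ0.le (by positivity) hm hz
    rw [hrad, ← hlm, div_div] at this
    exact this
  have hone : ∀ z, 1 ≤ Γ.ER z (27 * r) := fun z => h.one_le_ER z (by linarith)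
  set s := ⌊(n : ℝ) / (12 * l)⌋₊
  set t := ⌊(n : ℝ) / 2⌋₊
  have hs : ∀ z ∈ Γ.geod x y, K₁ * Γ.ER z (10 * k) ≤ s := by
    intro z hz
    have h1 : Γ.ER z (10 * k) ≤ Γ.ER z (27 * r) := h.ER_mono z (by linarith)
    have h2 : (n : ℝ) / (12 * l) < s + 1 := Nat.lt_floor_add_one _
    have h3 : (n : ℝ) / (12 * l) = n / (2 * l) / 6 := by field_simp; ring
    have h4 : 6 * (K₁ + 1) * Γ.ER z (27 * r) ≤ Q * Γ.ER z (27 * r) :=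
      mul_le_mul_of_nonneg_right (by linarith) (by linarith [hone z])
    have h5 := mul_le_mul_of_nonneg_left h1 hK₁.le
    linarith [hbase z hz, hone z]
  have hxg : x ∈ Γ.geod x y := mem_geod_iff.2 (by simp)
  have hyg : y ∈ Γ.geod x y := mem_geod_iff.2 (by simp)
  have ht : K₂ * Γ.ER x (5 * k) ≤ t := by
    have h1 : Γ.ER x (5 * k) ≤ Γ.ER x (27 * r) := h.ER_mono x (by linarith)
    have h2 : (n : ℝ) / 2 < t + 1 := Nat.lt_floor_add_one _
    have hl1 : 1 ≤ l := by rw [hlm]; exact_mod_cast hm0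
    have h3 : (n : ℝ) / (2 * l) ≤ n / 2 := by
      apply div_le_div_of_nonneg_left (by positivity) (by norm_num)
      linarith
    have h4 : (K₂ + 1) * Γ.ER x (27 * r) ≤ Q * Γ.ER x (27 * r) :=
      mul_le_mul_of_nonneg_right (by linarith) (by linarith [hone x])
    have h5 := mul_le_mul_of_nonneg_left h1 hK₂.le
    linarith [hbase x hxg, hone x]
  have htime : 6 * m * s + t ≤ n := by
    have h1 : (s : ℝ) ≤ n / (12 * l) := Nat.floor_le (by positivity)
    have h2 : (t : ℝ) ≤ n / 2 := Nat.floor_le (by positivity)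
    have h3 : 6 * l * s ≤ n / 2 := by
      calc 6 * l * s ≤ 6 * l * (n / (12 * l)) := mul_le_mul_of_nonneg_left h1 (by positivity)
        _ = n / 2 := by field_simp; ring
    have : (6 * m * s + t : ℝ) ≤ n := by rw [← hlm]; linarith
    exact_mod_cast this
  -- Rounding loses at most a factor 2, since r < k + 1 ≤ 2k; hence d = 3lr becomes 6lk.
  have hlen : Γ.graph.dist y x ≤ 6 * m * k := by
    have : d ≤ 6 * l * k := by rw [hdr]; nlinarith
    rw [hd, hlm, SimpleGraph.dist_comm] at this
    exact_mod_cast this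
  set a := c₂ * ((k : ℝ) ^ D)⁻¹
  have ha1 : a ≤ 1 :=
    mul_le_one₀ hc₂1 (by positivity) (inv_le_one_of_one_le₀ (one_le_pow₀ hk1'))
  have hchain := hhit.chain hc₁ hc₁1 hf hk1 (show 0 ≤ a by positivity) ha1 hs
    (fun v hv => hpoint x v k t hk1 hv ht) (6 * m) hyg hlen (by simp : Γ.graph.dist y y ≤ k)
  calc c₂ * ((r ^ D)⁻¹ * Real.exp (-(3 * D + 3 * L + 6 * M) * l))
      ≤ c₂ * (((k : ℝ) ^ D)⁻¹ * Real.exp ((6 * m : ℕ) * -M)) := by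
        have h1 : (r ^ D)⁻¹ ≤ ((k : ℝ) ^ D)⁻¹ := by gcongr
        have h2 : -(3 * D + 3 * L + 6 * M) * l ≤ (6 * m : ℕ) * -M := by
          push_cast
          rw [← hlm]
          nlinarith [mul_nonneg hDr.le hl0.le, mul_nonneg hL hl0.le]
        exact mul_le_mul_of_nonneg_left
          (mul_le_mul h1 (Real.exp_le_exp.2 h2) (Real.exp_pos _).le (by positivity)) hc₂.le
    _ = a * c₁ ^ (6 * m) := by rw [Real.exp_nat_mul, hcM, mul_assoc]
    _ ≤ _ := hchain
    _ ≤ _ := hf.hit_mono y htime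

end Walk

end WeightedGraph

end

theorem theorem5p1 {V : Type*} [MeasurableSpace V] [DiscreteMeasurableSpace V]
    (Γ : WeightedGraph V) (hp : Γ.CondP0) (hE : Γ.CondEbar) (hH : Γ.CondH) :
    ∃ Q₀ : ℝ, 0 < Q₀ ∧ ∀ Q : ℝ, Q₀ ≤ Q →
      ∃ c C D : ℝ, 0 < c ∧ 0 < C ∧ 0 < D ∧
        ∀ (x y : V) (n : ℕ), x ≠ y → Γ.graph.dist x y ≤ n →
          ∀ d l r : ℝ, d = Γ.graph.dist x y → l = Γ.chainLength Q 9 x y ((n : ℝ) / 2) d →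
            r = d / (3 * l) →
            c / (Γ.vol x (Γ.e x n) * r ^ D) * Real.exp (-C * l) ≤ Γ.heatTilde n x y := by
  obtain ⟨CE, hCE, hEb⟩ := hE.exists_bound hp
  obtain ⟨Q₀, c, C, D, hQ₀, hc, hC, hD, hhit⟩ := hp.exists_hit_lower_bound hE hH
  refine ⟨Q₀, hQ₀, fun Q hQ => ⟨((2 * CE)⁻¹) ^ 2 * c, C, D, by positivity, hC,
    by exact_mod_cast hD, ?_⟩⟩
  intro x y n hxy hn d l r hd hl hr
  obtain ⟨hl0, hlow⟩ := hhit Q hQ x y n hxy hn d l hd hl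
  set a := ((2 * CE)⁻¹) ^ 2 / Γ.vol x (Γ.e x n)
  have ha : 0 ≤ a := div_nonneg (by positivity) (hp.locallyFin.vol_nonneg _ _)
  have hdiag := hp.locallyFin.mul_hit_le_heatTilde hxy (n := n) (a := a)
    fun j hj => hEb.diagonal hCE hp x hj
  refine le_trans (le_of_eq ?_) ((mul_le_mul_of_nonneg_left hlow ha).trans hdiag)
  rw [Real.rpow_natCast, hr, div_eq_mul_inv, mul_inv]
  simp only [a, div_eq_mul_inv]
  ring
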